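/- Theorem 2. Let $A,B$ be integers such that $|A|$ and $|B|$ are primes, $A\equiv 1\pmod 8$, $B\equiv 3\pmod 8$, and such that $A+B\ge 0$ or $AB<0$. Let $r$ be a prime number coprime to $AB(A-B)$ such that (i) $r\equiv 7\pmod 8$; (ii) $\left(\frac{A}{r}\right)=\left(\frac{B}{r}\right)=-1$; (iii) $\left(\frac{-Br}{p}\right)=-1$ for every odd prime $p$ dividing $A-B$ (Legendre symbols). Let $E=E^{A,B}_r: y^2=x(x+Ar)(x+Br)$ be the quadratic twist by $r$ of the elliptic curve $E^{A,B}:y^2=x(x+A)(x+B)$ over $\mathbb{Q}$, let $\widehat{E}: Y^2=X^3-2(A+B)rX^2+(A-B)^2r^2X$, let $\phi:E\to\widehat{E}$, $\phi(x,y)=\left(y^2/x^2,\,-y(x^2-ABr^2)/x^2\right)$, be the 2-isogeny with kernel $\{O,(0,0)\}$, and let $\widehat{\phi}:\widehat{E}\to E$ be the dual isogeny. Then the Mordell-Weil group $E(\mathbb{Q})$ has rank $0$; moreover $\mathrm{Sel}^{(\phi)}(E/\mathbb{Q})$ is trivial and $\mathrm{Sel}^{(\widehat{\phi})}(\widehat{E}/\mathbb{Q})\simeq(\mathbb{Z}/2\mathbb{Z})^2$.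 -/

import Mathlib

noncomputable section

namespace TwoDescent

open WeierstrassCurve

/-- The curve `E^{A,B} : y² = x (x + A) (x + B)`, i.e. `y² = x³ + (A + B) x² + A B x`, over `ℚ`. -/
def curveAB (A B : ℤ) : WeierstrassCurve ℚ :=
  ⟨0, (A : ℚ) + B, 0, (A : ℚ) * B, 0⟩

/-- The quadratic twist by `d` of a curve `y² = x³ + a x² + b x + c` (only used for curves with
`a₁ = a₃ = 0`), namely `y² = x³ + a d x² + b d² x + c d³`. -/
def twist (W : WeierstrassCurve ℚ) (d : ℚ) : WeierstrassCurve ℚ :=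
  ⟨0, W.a₂ * d, 0, W.a₄ * d ^ 2, W.a₆ * d ^ 3⟩

theorem curveAB_equation (A B : ℤ) (x y : ℚ) :
    Affine.Equation (curveAB A B) x y ↔ y ^ 2 = x * (x + A) * (x + B) := by
  rw [Affine.equation_iff]
  simp only [curveAB]
  constructor <;> intro h <;> linear_combination h

/-- The curve `y² = x³ + a x² + b x`, the general curve with the rational `2`-torsion
point `(0, 0)`. -/
def curve2 {K : Type*} [Field K] (a b : K) : WeierstrassCurve K :=
  ⟨0, a, 0, b, 0⟩

theorem twist_curveAB (A B : ℤ) (d : ℚ) :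
    twist (curveAB A B) d = curve2 (((A : ℚ) + B) * d) ((A : ℚ) * B * d ^ 2) := by
  simp [twist, curveAB, curve2]

section Local

open scoped Classical

variable {K : Type*} [Field K]

/-- The group of points of `y² = x³ + a x² + b x` over the algebraic closure of `K`. -/
abbrev GeomPoint (a b : K) : Type _ :=
  Affine.Point (Affine.baseChange (curve2 a b) (AlgebraicClosure K))

/-- The action of an element of the absolute Galois group of `K` on geometric points. -/
def galAct (a b : K) (σ : AlgebraicClosure K ≃ₐ[K] AlgebraicClosure K) :
    GeomPoint a b →+ GeomPoint a b :=
  Affine.Point.map (W' := curve2 a b) (σ : AlgebraicClosure K →ₐ[K] AlgebraicClosure K)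

/-- The `2`-torsion point `(0, 0)`. (It is nonsingular as soon as `b ≠ 0`;
otherwise a default value is taken.) -/
def originPoint (a b : K) : GeomPoint a b :=
  if h : Affine.Nonsingular (Affine.baseChange (curve2 a b) (AlgebraicClosure K)) 0 0 then
    Affine.Point.some 0 0 h
  else 0

theorem originPoint_eq (a b : K) (hb : b ≠ 0) : ∃ h,
    originPoint a b = Affine.Point.some 0 0 h := by
  have h : Affine.Nonsingular (Affine.baseChange (curve2 a b) (AlgebraicClosure K)) 0 0 := by
    rw [Affine.nonsingular_zero]
    simp [curve2, WeierstrassCurve.baseChange, hb]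
  exact ⟨h, dif_pos h⟩

/-- Let `T = (0, 0)`, so that `{O, T}`, with trivial Galois action, is the kernel of the
`2`-isogeny `φ`, `φ(x, y) = (y²/x², -y (x² - b)/x²)`, from `E : y² = x³ + a x² + b x`.
A class `d ∈ Kˣ/(Kˣ)² = H¹(K, {O, T})` is represented by the cocycle sending `σ` to `O`
if `σ √d = √d` and to `T` otherwise. The predicate says that its image in `H¹(K, E)` is trivial,
i.e. that this cocycle is the coboundary `σ ↦ σ P - P` of a geometric point `P` of `E`. -/
def TrivialInH1 (a b d : K) : Prop :=
  ∃ P : GeomPoint a b, ∀ (σ : AlgebraicClosure K ≃ₐ[K] AlgebraicClosure K) (s : AlgebraicClosure K),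
    s ^ 2 = algebraMap K (AlgebraicClosure K) d →
      galAct a b σ P - P = if σ s = s then 0 else originPoint a b

theorem originPoint_add_self (a b : K) : originPoint a b + originPoint a b = 0 := by
  unfold originPoint
  split_ifs with h
  · exact Affine.Point.add_of_Y_eq rfl (by simp [Affine.negY, curve2, WeierstrassCurve.baseChange])
  · simp

theorem TrivialInH1.one (a b : K) : TrivialInH1 a b 1 := by
  refine ⟨0, fun σ s hs => ?_⟩
  rw [map_one, sq_eq_one_iff] at hs
  rcases hs with rfl | rfl <;> simp

theorem TrivialInH1.inv {a b d : K} (h : TrivialInH1 a b d) : TrivialInH1 a b d⁻¹ := by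
  obtain ⟨P, hP⟩ := h
  refine ⟨P, fun σ s hs => ?_⟩
  rw [hP σ s⁻¹ (by rw [inv_pow, hs, map_inv₀, inv_inv])]
  simp

theorem TrivialInH1.mul {a b d e : K} (hd0 : d ≠ 0) (he0 : e ≠ 0) (h2 : (2 : K) ≠ 0)
    (hd : TrivialInH1 a b d) (he : TrivialInH1 a b e) : TrivialInH1 a b (d * e) := by
  obtain ⟨P, hP⟩ := hd
  obtain ⟨Q, hQ⟩ := he
  refine ⟨P + Q, fun σ u hu => ?_⟩
  obtain ⟨s, hs⟩ := IsAlgClosed.exists_pow_nat_eq (algebraMap K (AlgebraicClosure K) d)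
    (n := 2) (by norm_num)
  have hd0' : algebraMap K (AlgebraicClosure K) d ≠ 0 := by simpa using hd0
  have he0' : algebraMap K (AlgebraicClosure K) e ≠ 0 := by simpa using he0
  have h2' : (2 : AlgebraicClosure K) ≠ 0 := by
    have := (map_ne_zero (algebraMap K (AlgebraicClosure K))).2 h2
    rwa [map_ofNat] at this
  have hs0 : s ≠ 0 := by rintro rfl; exact hd0' (by rw [← hs]; simp)
  obtain ⟨t, rfl⟩ : ∃ t, u = s * t := ⟨u / s, by field_simp⟩
  have ht : t ^ 2 = algebraMap K (AlgebraicClosure K) e := by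
    rw [mul_pow, hs, map_mul] at hu
    exact mul_left_cancel₀ hd0' hu
  have e1 : galAct a b σ (P + Q) - (P + Q) = (galAct a b σ P - P) + (galAct a b σ Q - Q) := by
    rw [map_add]; abel
  rw [e1, hP σ s hs, hQ σ t ht, map_mul]
  have key : ∀ v : AlgebraicClosure K, ∀ c : K, v ^ 2 = algebraMap K _ c →
      σ v = v ∨ σ v = -v := fun v c hv => by
    apply sq_eq_sq_iff_eq_or_eq_neg.1
    rw [← map_pow, hv, AlgEquiv.commutes]
  have neg_ne : ∀ v : AlgebraicClosure K, v ≠ 0 → -v ≠ v := fun v hv h => by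
    have : 2 * v = 0 := by linear_combination -h
    rcases mul_eq_zero.1 this with h | h
    · exact h2' h
    · exact hv h
  have ht0 : t ≠ 0 := by rintro rfl; exact he0' (by rw [← ht]; simp)
  rcases key s d hs with h | h <;> rcases key t e ht with h' | h' <;> rw [h, h'] <;>
      simp [neg_ne s hs0, neg_ne t ht0, neg_ne (s * t) (mul_ne_zero hs0 ht0),
        originPoint_add_self]

end Local

/-- The `d ∈ ℚˣ` whose class in `ℚˣ/(ℚˣ)² = H¹(ℚ, {O, (0, 0)})` becomes trivial in `H¹(ℚ_v, E)`
for every place `v` of `ℚ`, where `E : y² = x³ + a x² + b x`. -/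
def selmerLift (a b : ℚ) : Subgroup ℚˣ where
  carrier := {d | (∀ (p : ℕ) [Fact p.Prime],
      TrivialInH1 (a : ℚ_[p]) (b : ℚ_[p]) (((d : ℚ) : ℚ_[p]))) ∧
    TrivialInH1 (a : ℝ) (b : ℝ) (((d : ℚ) : ℝ))}
  one_mem' := by
    refine ⟨fun p _ => ?_, ?_⟩
    · simpa using TrivialInH1.one (a : ℚ_[p]) (b : ℚ_[p])
    · simpa using TrivialInH1.one (a : ℝ) (b : ℝ)
  mul_mem' := by
    intro d e hd he
    refine ⟨fun p _ => ?_, ?_⟩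
    · have := (hd.1 p).mul (by exact_mod_cast d.ne_zero) (by exact_mod_cast e.ne_zero)
        two_ne_zero (he.1 p)
      simpa using this
    · have := hd.2.mul (by exact_mod_cast d.ne_zero) (by exact_mod_cast e.ne_zero)
        two_ne_zero he.2
      simpa using this
  inv_mem' := by
    intro d hd
    refine ⟨fun p _ => ?_, ?_⟩
    · simpa using (hd.1 p).inv
    · simpa using hd.2.inv

/-- The quotient curve `Ê : Y² = X³ - 2 a X² + (a² - 4 b) X` of `E : y² = x³ + a x² + b x` by
`{O, (0, 0)}` (only used for curves `W` of the latter form, with `a = W.a₂` and `b = W.a₄`),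
which is the target of the `2`-isogeny `φ(x, y) = (y²/x², -y (x² - b)/x²)`.
The dual isogeny from `Ê` to `E` has kernel `{O, (0, 0)}` as well. -/
def dualCurve (W : WeierstrassCurve ℚ) : WeierstrassCurve ℚ :=
  curve2 (-2 * W.a₂) (W.a₂ ^ 2 - 4 * W.a₄)

theorem dualCurve_twist_curveAB (A B : ℤ) (d : ℚ) :
    dualCurve (twist (curveAB A B) d) =
      curve2 (-2 * ((A : ℚ) + B) * d) (((A : ℚ) - B) ^ 2 * d ^ 2) := by
  simp only [dualCurve, twist, curveAB, curve2, WeierstrassCurve.mk.injEq, true_and]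
  refine ⟨by ring, by ring, trivial⟩

/-- The Selmer group, inside `ℚˣ/(ℚˣ)² = H¹(ℚ, {O, (0, 0)})`, of the `2`-isogeny with kernel
`{O, (0, 0)}` out of the curve `W : y² = x³ + a x² + b x` (only used for curves of this form,
with `a = W.a₂` and `b = W.a₄`). -/
def selmer (W : WeierstrassCurve ℚ) : Subgroup (ℚˣ ⧸ (powMonoidHom 2 : ℚˣ →* ℚˣ).range) :=
  (selmerLift W.a₂ W.a₄).map (QuotientGroup.mk' _)

/-- The rank of the Mordell-Weil group `W(ℚ)`, as a cardinal number. -/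
def mordellWeilRank (W : WeierstrassCurve ℚ) : Cardinal :=
  Module.rank ℤ (Affine.Point W)

end TwoDescent
end

/-! Both Selmer groups are computed prime by prime. A class is represented by a squarefree integer
`D`; if it is trivial in `H¹(K, E)`, then `D` is a square in `K` or the quartic `u² = D ((D t² - a)²
- 4 b)` has a point over `K` (`TrivialInH1.torsorHasPoint`). Each unwanted `D` is excluded at one
well-chosen place.

For `φ`, the sign condition and the real place force `D > 0`. An odd prime `p ≠ r` dividing `D` must
divide `A - B`, and then `-B r` would be a square mod `p`. The place `r` excludes `r ∣ D`, because
`-1`, `A`, `B` are nonresidues and `2` is a residue mod `r`; the place `2` excludes `D = 2`. So only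
`D = 1` is left (`eq_one_of_torsorHasPoint`).

For the dual isogeny, the primes dividing `D` divide `A B r`. The 2-torsion points of `E` supply the
classes of `-A r`, `-B r` and `A B`; multiplying by them removes `A` and `B` and leaves `±1`, `±r`.
Of these, `-1` and `-r` fail at `r`, and `r` fails at `2`. The group is therefore the image of the
2-torsion, of order four (`isSquare_or_of_mem_dualLift`).

For the rank, the two descents together show that every rational point lies in `2 E(ℚ)` up to
2-torsion. Halving divides the height by four up to a constant, so iterated halves stay in a set of
bounded height, which is finite. Two of them coincide, which makes the point torsion
(`torsion_of_descent`); finite generation of `E(ℚ)` is not needed. -/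

noncomputable section

namespace TwoDescent

open WeierstrassCurve

/-! ### Trivial cohomology classes and points on the quartic torsors. -/

section Torsor

open scoped Classical

variable {K : Type*} [Field K]

/-- The principal homogeneous space `u² = d ((d t² - a)² - 4 b)` attached to the class `d` has a
point over `K`; the points at infinity are rational exactly if `d` is a square. -/
def TorsorHasPoint (a b d : K) : Prop :=
  IsSquare d ∨ ∃ t u : K, u ^ 2 = d * ((d * t ^ 2 - a) ^ 2 - 4 * b)

theorem TorsorHasPoint.of_mul_sq {a b d c : K} (hc : c ≠ 0)
    (h : TorsorHasPoint a b (d * c ^ 2)) : TorsorHasPoint a b d := by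
  rcases h with ⟨x, h⟩ | ⟨t, u, h⟩
  · exact Or.inl ⟨x / c, by field_simp; linear_combination h⟩
  · refine Or.inr ⟨c * t, u / c, ?_⟩
    field_simp
    linear_combination h

theorem exists_algebraMap_of_fixed [CharZero K] (x : AlgebraicClosure K)
    (h : ∀ σ : AlgebraicClosure K ≃ₐ[K] AlgebraicClosure K, σ x = x) :
    ∃ c : K, algebraMap K (AlgebraicClosure K) c = x :=
  IntermediateField.mem_bot.1 ((InfiniteGalois.mem_bot_iff_fixed x).2 h)

theorem geomPoint_equation {a b : K} {x y : AlgebraicClosure K}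
    (h : Affine.Equation (Affine.baseChange (curve2 a b) (AlgebraicClosure K)) x y) :
    y ^ 2 = x ^ 3 + algebraMap K _ a * x ^ 2 + algebraMap K _ b * x := by
  rw [Affine.equation_iff] at h
  simpa [curve2, WeierstrassCurve.baseChange] using h

theorem geomPoint_nonsingular {a b : K} {x y : AlgebraicClosure K}
    (hy : y ≠ 0) (h2 : (2 : AlgebraicClosure K) ≠ 0)
    (h : y ^ 2 = x ^ 3 + algebraMap K _ a * x ^ 2 + algebraMap K _ b * x) :
    Affine.Nonsingular (Affine.baseChange (curve2 a b) (AlgebraicClosure K)) x y := by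
  rw [Affine.nonsingular_iff, Affine.equation_iff]
  constructor
  · simpa [curve2, WeierstrassCurve.baseChange] using h
  · right
    simp only [curve2, WeierstrassCurve.baseChange, WeierstrassCurve.map_a₁,
      WeierstrassCurve.map_a₃, map_zero, zero_mul, sub_zero]
    intro h'
    have : 2 * y = 0 := by linear_combination h'
    exact (mul_ne_zero h2 hy) this

/-- The explicit translation shows that `y / x` and `x - b / x` change sign under adding `(0, 0)`,
exactly as `√d` does under conjugation. -/
theorem originPoint_add_some {a b : K} (hb : b ≠ 0) {x y : AlgebraicClosure K}
    (h : Affine.Nonsingular (Affine.baseChange (curve2 a b) (AlgebraicClosure K)) x y)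
    (hx : x ≠ 0) : ∃ h', originPoint a b + Affine.Point.some x y h =
      Affine.Point.some (algebraMap K _ b / x) (-(algebraMap K _ b * y / x ^ 2)) h' := by
  obtain ⟨h0, e0⟩ := originPoint_eq a b hb
  have he := geomPoint_equation h.1
  rw [e0, Affine.Point.add_of_X_ne hx.symm]
  have hs : Affine.slope (Affine.baseChange (curve2 a b) (AlgebraicClosure K)) 0 x 0 y = y / x := by
    rw [Affine.slope_of_X_ne hx.symm, zero_sub, zero_sub, neg_div_neg_eq]
  have hX : Affine.addX (Affine.baseChange (curve2 a b) (AlgebraicClosure K)) 0 x (y / x) =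
      algebraMap K _ b / x := by
    simp only [Affine.addX, curve2, WeierstrassCurve.baseChange, WeierstrassCurve.map_a₁,
      WeierstrassCurve.map_a₂, map_zero]
    field_simp
    linear_combination he
  have hY : Affine.addY (Affine.baseChange (curve2 a b) (AlgebraicClosure K)) 0 x 0 (y / x) =
      -(algebraMap K _ b * y / x ^ 2) := by
    simp only [Affine.addY, Affine.negAddY, hX]
    simp [Affine.negY, curve2, WeierstrassCurve.baseChange]
    field_simp
  have key : ∀ X Y X' Y' (hn : Affine.Nonsingular
      (Affine.baseChange (curve2 a b) (AlgebraicClosure K)) X Y), X = X' → Y = Y' →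
      ∃ h', Affine.Point.some X Y hn = Affine.Point.some X' Y' h' := by
    rintro X Y _ _ hn rfl rfl
    exact ⟨hn, rfl⟩
  apply key
  · rw [hs, hX]
  · rw [hs, hY]

/-- If `σ` negates `s = √d`, it translates `P = (x, y)` by `(0, 0)`; otherwise it fixes `P`. Hence
`t = y / (x s)` and `u = s (x - b / x)` descend to `K`, and `(y / x)² = x + a + b / x` yields the
quartic. If `P` is `O` or `(0, 0)`, it is fixed by every `σ`, so `d` is a square. -/
theorem TrivialInH1.torsorHasPoint [CharZero K] {a b d : K} (hb : b ≠ 0) (hd : d ≠ 0)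
    (h : TrivialInH1 a b d) : TorsorHasPoint a b d := by
  obtain ⟨P, hP⟩ := h
  obtain ⟨s, hs⟩ := IsAlgClosed.exists_pow_nat_eq (algebraMap K (AlgebraicClosure K) d)
    (n := 2) (by norm_num)
  have hd' : algebraMap K (AlgebraicClosure K) d ≠ 0 := by simpa using hd
  have hs0 : s ≠ 0 := by rintro rfl; exact hd' (by rw [← hs]; simp)
  obtain ⟨hT, eT⟩ := originPoint_eq a b hb
  have hsq : (∀ σ : AlgebraicClosure K ≃ₐ[K] AlgebraicClosure K, σ s = s) → IsSquare d := by
    intro hfix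
    obtain ⟨c, rfl⟩ := exists_algebraMap_of_fixed s hfix
    rw [← map_pow] at hs
    exact ⟨c, by rw [← pow_two]; exact ((algebraMap K (AlgebraicClosure K)).injective hs).symm⟩
  have hfix : (∀ σ, galAct a b σ P = P) → IsSquare d := by
    intro h
    refine hsq fun σ => ?_
    by_contra hne
    have := hP σ s hs
    rw [if_neg hne, h, sub_self, eT] at this
    exact Affine.Point.some_ne_zero _ this.symm
  rcases P with _ | ⟨x, y, hxy⟩
  · exact Or.inl (hfix fun σ => rfl)
  have he := geomPoint_equation hxy.1
  by_cases hx : x = 0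
  · subst hx
    have hy : y = 0 := by simpa using he
    subst hy
    refine Or.inl (hfix fun σ => ?_)
    simp [galAct, Affine.Point.map_some]
  right
  have hact : ∀ σ : AlgebraicClosure K ≃ₐ[K] AlgebraicClosure K, (σ s = s ∧ σ x = x ∧ σ y = y) ∨
      (σ s = -s ∧ σ x = algebraMap K _ b / x ∧ σ y = -(algebraMap K _ b * y / x ^ 2)) := by
    intro σ
    have h1 := hP σ s hs
    have h2 : σ s = s ∨ σ s = -s := by
      apply sq_eq_sq_iff_eq_or_eq_neg.1
      rw [← map_pow, hs, AlgEquiv.commutes]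
    by_cases h3 : σ s = s
    · rw [if_pos h3, sub_eq_zero] at h1
      simp only [galAct, Affine.Point.map_some, Affine.Point.some.injEq] at h1
      exact Or.inl ⟨h3, h1⟩
    · rw [if_neg h3, sub_eq_iff_eq_add] at h1
      obtain ⟨h', e'⟩ := originPoint_add_some hb hxy hx
      rw [e'] at h1
      simp only [galAct, Affine.Point.map_some, Affine.Point.some.injEq] at h1
      exact Or.inr ⟨h2.resolve_left h3, h1⟩
  have hb' : algebraMap K (AlgebraicClosure K) b ≠ 0 := by simpa using hb
  obtain ⟨t, ht⟩ := exists_algebraMap_of_fixed (y / x / s) (by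
    intro σ
    rcases hact σ with ⟨h1, h2, h3⟩ | ⟨h1, h2, h3⟩
    · simp [h1, h2, h3]
    · rw [map_div₀, map_div₀, h1, h2, h3]; field_simp)
  obtain ⟨u, hu⟩ := exists_algebraMap_of_fixed (s * (x - algebraMap K _ b / x)) (by
    intro σ
    rcases hact σ with ⟨h1, h2, h3⟩ | ⟨h1, h2, h3⟩
    · simp [h1, h2]
    · rw [map_mul, map_sub, map_div₀, h1, h2, AlgEquiv.commutes]; field_simp; ring)
  refine ⟨t, u, (algebraMap K (AlgebraicClosure K)).injective ?_⟩
  simp only [map_mul, map_sub, map_pow, ht, hu, ← hs, map_ofNat]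
  field_simp
  rw [he]
  field_simp
  ring

/-- The abscissa is a root in `K(√d)` of `X² - (d t² - a) X + b`. The roots have product `b`, so
conjugation, which swaps them, acts as translation by `(0, 0)`. The condition `t ≠ 0` makes the
ordinate nonzero, which gives nonsingularity without assuming `a² ≠ 4 b`. -/
theorem trivialInH1_of_torsor [CharZero K] {a b d t u : K} (hb : b ≠ 0) (hd : d ≠ 0)
    (ht : t ≠ 0) (h : u ^ 2 = d * ((d * t ^ 2 - a) ^ 2 - 4 * b)) : TrivialInH1 a b d := by
  obtain ⟨s₀, hs₀⟩ := IsAlgClosed.exists_pow_nat_eq (algebraMap K (AlgebraicClosure K) d)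
    (n := 2) (by norm_num)
  set f := algebraMap K (AlgebraicClosure K) with hf
  have hd' : f d ≠ 0 := by simpa [hf] using hd
  have hb' : f b ≠ 0 := by simpa [hf] using hb
  have ht' : f t ≠ 0 := by simpa [hf] using ht
  have hs0 : s₀ ≠ 0 := by rintro rfl; exact hd' (by rw [← hs₀]; simp)
  have h2 : (2 : AlgebraicClosure K) ≠ 0 := two_ne_zero
  have hu : f u ^ 2 = s₀ ^ 2 * ((s₀ ^ 2 * f t ^ 2 - f a) ^ 2 - 4 * f b) := by
    have := congrArg f h
    simpa [map_ofNat, ← hs₀] using this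
  set x := (s₀ ^ 2 * f t ^ 2 - f a + f u / s₀) / 2 with hx
  set x' := (s₀ ^ 2 * f t ^ 2 - f a - f u / s₀) / 2 with hx'
  have hxx : x * x' = f b := by
    rw [hx, hx']
    field_simp
    linear_combination -hu
  have hx0 : x ≠ 0 := left_ne_zero_of_mul (hxx ▸ hb')
  have hsum : x + x' = s₀ ^ 2 * f t ^ 2 - f a := by rw [hx, hx']; ring
  have heq : (s₀ * f t * x) ^ 2 = x ^ 3 + f a * x ^ 2 + f b * x := by
    rw [← hxx]
    linear_combination (-x ^ 2) * hsum
  have hns := geomPoint_nonsingular (mul_ne_zero (mul_ne_zero hs0 ht') hx0) h2 heq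
  refine ⟨Affine.Point.some _ _ hns, fun σ s hs => ?_⟩
  have hss : s = s₀ ∨ s = -s₀ := sq_eq_sq_iff_eq_or_eq_neg.1 (by rw [hs, hs₀])
  have hiff : σ s = s ↔ σ s₀ = s₀ := by rcases hss with rfl | rfl <;> simp
  have hc : ∀ c, σ (f c) = f c := fun c => AlgEquiv.commutes σ c
  have hσ : σ s₀ = s₀ ∨ σ s₀ = -s₀ := by
    apply sq_eq_sq_iff_eq_or_eq_neg.1
    rw [← map_pow, hs₀, hc]
  have hσ2 : σ s₀ ^ 2 = s₀ ^ 2 := by rcases hσ with h | h <;> rw [h]; ring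
  by_cases h3 : σ s₀ = s₀
  · rw [if_pos (hiff.2 h3), sub_eq_zero]
    simp only [galAct, Affine.Point.map_some, Affine.Point.some.injEq]
    have h4 : σ x = x := by
      rw [hx]
      simp only [map_div₀, map_add, map_sub, map_mul, map_pow, hc, h3, map_ofNat]
    refine ⟨h4, ?_⟩
    have : σ (s₀ * f t * x) = s₀ * f t * x := by
      rw [map_mul, map_mul, h3, hc, h4]
    exact this
  · have h5 := hσ.resolve_left h3
    rw [if_neg (fun h => h3 (hiff.1 h)), sub_eq_iff_eq_add]
    obtain ⟨h', e'⟩ := originPoint_add_some hb hns hx0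
    rw [e']
    simp only [galAct, Affine.Point.map_some, Affine.Point.some.injEq]
    have h4 : σ x = f b / x := by
      rw [eq_div_iff hx0, ← hxx, mul_comm]
      congr 1
      rw [hx, hx']
      simp only [map_div₀, map_add, map_sub, map_mul, map_pow, hc, h5, map_ofNat]
      ring
    refine ⟨h4, ?_⟩
    have : σ (s₀ * f t * x) = -(f b * (s₀ * f t * x) / x ^ 2) := by
      rw [map_mul, map_mul, h5, hc, h4]
      field_simp
    exact this

end Torsor

/-! ### Valuation arguments on the quartics over `ℚ_p`. -/

section Padic

variable {p : ℕ} [Fact p.Prime]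

theorem exists_padicInt_coe_eq {x : ℚ_[p]} (hx : ‖x‖ ≤ 1) : ∃ z : ℤ_[p], (z : ℚ_[p]) = x :=
  ⟨⟨x, hx⟩, rfl⟩

theorem norm_eq_of_norm_sub_lt {x z : ℚ_[p]} (h : ‖x - z‖ < ‖z‖) : ‖x‖ = ‖z‖ := by
  have := IsUltrametricDist.norm_add_eq_max_of_norm_ne_norm (x := x - z) (y := z) h.ne
  rwa [sub_add_cancel, max_eq_right h.le] at this

theorem norm_add_lt {x y : ℚ_[p]} {c : ℝ} (hx : ‖x‖ < c) (hy : ‖y‖ < c) : ‖x + y‖ < c :=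
  (Padic.nonarchimedean x y).trans_lt (max_lt hx hy)

theorem norm_add_le' {x y : ℚ_[p]} {c : ℝ} (hx : ‖x‖ ≤ c) (hy : ‖y‖ ≤ c) : ‖x + y‖ ≤ c :=
  (Padic.nonarchimedean x y).trans (max_le hx hy)

theorem norm_le_inv_of_lt_one {x : ℚ_[p]} (h : ‖x‖ < 1) : ‖x‖ ≤ (p : ℝ)⁻¹ := by
  have := (Padic.norm_le_pow_iff_norm_lt_pow_add_one x (-1)).2 (by simpa using h)
  simpa using this

theorem norm_intCast_eq_one {n : ℤ} (h : ¬ (p : ℤ) ∣ n) : ‖(n : ℚ_[p])‖ = 1 :=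
  le_antisymm (Padic.norm_int_le_one n) (not_lt.1 fun h' => h ((Padic.norm_intCast_lt_one_iff (k := n)).1 h'))

theorem norm_intCast_of_squarefree {D : ℤ} (hD : Squarefree D) (h : (p : ℤ) ∣ D) :
    ‖(D : ℚ_[p])‖ = (p : ℝ)⁻¹ := by
  obtain ⟨m, rfl⟩ := h
  have : ¬ (p : ℤ) ∣ m := by
    intro hm
    have := hD p (mul_dvd_mul_left _ hm)
    exact (Nat.prime_iff_prime_int.1 (Fact.out : p.Prime)).not_isUnit this
  push_cast
  rw [norm_mul, norm_intCast_eq_one this, Padic.norm_p, mul_one]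

/-- A uniformizer times a square is not a square, in terms of norms. -/
theorem eq_zero_of_norm_sq_eq {D u z : ℚ_[p]} (hD : ‖D‖ = (p : ℝ)⁻¹)
    (h : ‖u‖ ^ 2 = ‖D‖ * ‖z‖ ^ 2) : z = 0 := by
  by_contra hz
  have hp : (1 : ℝ) < p := by exact_mod_cast (Fact.out : p.Prime).one_lt
  have hu : u ≠ 0 := by
    rintro rfl
    rw [hD] at h
    have : 0 < ‖z‖ := norm_pos_iff.2 hz
    have h3 : 0 < (p : ℝ)⁻¹ * ‖z‖ ^ 2 := by positivity
    rw [← h] at h3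
    simp at h3
  rw [hD, Padic.norm_eq_zpow_neg_valuation hu, Padic.norm_eq_zpow_neg_valuation hz,
    ← zpow_natCast, ← zpow_natCast, ← zpow_mul, ← zpow_mul, ← zpow_neg_one,
    ← zpow_add₀ (by positivity)] at h
  have := zpow_right_injective₀ (by positivity) hp.ne' h
  push_cast at this
  omega

theorem norm_le_one_of_norm_mul_sq_le {D t : ℚ_[p]} (hD : (p : ℝ)⁻¹ ≤ ‖D‖)
    (h : ‖D * t ^ 2‖ ≤ 1) : ‖t‖ ≤ 1 := by
  by_contra! ht
  have hp : (1 : ℝ) < p := by exact_mod_cast (Fact.out : p.Prime).one_lt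
  have hi : ‖t⁻¹‖ ≤ (p : ℝ)⁻¹ := norm_le_inv_of_lt_one (by rw [norm_inv]; exact inv_lt_one_of_one_lt₀ ht)
  rw [norm_inv] at hi
  have h1 : (p : ℝ) ≤ ‖t‖ := (inv_le_inv₀ (by positivity) (by positivity)).1 hi
  rw [norm_mul, norm_pow] at h
  have h2 : (p : ℝ)⁻¹ * (p : ℝ) ^ 2 ≤ ‖D‖ * ‖t‖ ^ 2 := by gcongr
  rw [pow_two, inv_mul_cancel_left₀ (by positivity)] at h2
  linarith

theorem isSquare_zmod_of_norm_sub_lt {y : ℚ_[p]} {n : ℤ} (h : ‖y ^ 2 - n‖ < 1) :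
    IsSquare (n : ZMod p) := by
  have hy : ‖y‖ ≤ 1 := by
    have h1 : ‖y ^ 2‖ ≤ 1 := by
      have := norm_add_le' h.le (Padic.norm_int_le_one (p := p) n)
      rwa [sub_add_cancel] at this
    rw [norm_pow] at h1
    exact (pow_le_one_iff_of_nonneg (norm_nonneg _) two_ne_zero).1 h1
  obtain ⟨y, rfl⟩ := exists_padicInt_coe_eq hy
  have h2 : ‖y ^ 2 - (n : ℤ_[p])‖ < 1 := by
    rw [PadicInt.norm_def]; push_cast; exact h
  rw [PadicInt.norm_lt_one_iff_dvd, ← Ideal.mem_span_singleton, ← PadicInt.maximalIdeal_eq_span_p,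
    ← PadicInt.ker_toZMod, RingHom.mem_ker] at h2
  refine ⟨PadicInt.toZMod y, ?_⟩
  rw [map_sub, map_pow, map_intCast, sub_eq_zero] at h2
  rw [← h2, pow_two]

/-- The dominant term of a monic quadratic polynomial at a non-integral argument. -/
theorem norm_quadratic_of_one_lt {X : ℚ_[p]} (c₁ c₂ : ℤ) (hX : 1 < ‖X‖) :
    ‖X ^ 2 + c₁ * X + c₂‖ = ‖X‖ ^ 2 := by
  rw [← norm_pow]
  apply norm_eq_of_norm_sub_lt
  have h1 : ‖(c₁ : ℚ_[p]) * X‖ ≤ ‖X‖ := by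
    rw [norm_mul]
    exact mul_le_of_le_one_left (norm_nonneg _) (Padic.norm_int_le_one _)
  have h2 : ‖(c₂ : ℚ_[p])‖ ≤ ‖X‖ := (Padic.norm_int_le_one _).trans hX.le
  have h3 := norm_add_le' h1 h2
  rw [show X ^ 2 + c₁ * X + c₂ - X ^ 2 = c₁ * X + c₂ by ring, norm_pow]
  nlinarith

theorem norm_quadratic_le_one {X : ℚ_[p]} (c₁ c₂ : ℤ) (hX : ‖X‖ ≤ 1) :
    ‖X ^ 2 + c₁ * X + c₂‖ ≤ 1 := by
  obtain ⟨X, rfl⟩ := exists_padicInt_coe_eq hX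
  have := PadicInt.norm_le_one (X ^ 2 + (c₁ : ℤ_[p]) * X + (c₂ : ℤ_[p]))
  rw [PadicInt.norm_def] at this
  push_cast at this
  exact this

theorem norm_le_one_of_sq_eq {D X u : ℚ_[p]} (hD : ‖D‖ = (p : ℝ)⁻¹) {c₁ c₂ : ℤ}
    (h : u ^ 2 = D * (X ^ 2 + c₁ * X + c₂)) : ‖X‖ ≤ 1 := by
  by_contra! hX
  have := congrArg norm h
  rw [norm_mul, norm_quadratic_of_one_lt _ _ hX, norm_pow] at this
  have := eq_zero_of_norm_sq_eq hD this
  simp [this] at hX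
  linarith

/-- For `t ≠ 0`, `D t²` has odd valuation, so once integral it cannot be a unit. -/
theorem norm_lt_one_of_sq_eq {D t u : ℚ_[p]} (hD : ‖D‖ = (p : ℝ)⁻¹) {c₁ c₂ : ℤ}
    (h : u ^ 2 = D * ((D * t ^ 2) ^ 2 + c₁ * (D * t ^ 2) + c₂)) : ‖D * t ^ 2‖ < 1 := by
  refine lt_of_le_of_ne (norm_le_one_of_sq_eq hD h) fun h1 => ?_
  rw [norm_mul, norm_pow] at h1
  have := eq_zero_of_norm_sq_eq (u := 1) hD (z := t) (by rw [h1]; simp)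
  simp [this] at h1

/-- Over `ℚ_p`, the class of a prime element has no torsor point if `p` does not divide the
discriminant term `c₂`. -/
theorem dvd_of_sq_eq {D t u : ℚ_[p]} (hD : ‖D‖ = (p : ℝ)⁻¹) {c₁ c₂ : ℤ}
    (h : u ^ 2 = D * ((D * t ^ 2) ^ 2 + c₁ * (D * t ^ 2) + c₂)) : (p : ℤ) ∣ c₂ := by
  by_contra hc
  have hX := norm_lt_one_of_sq_eq hD h
  have hc1 := norm_intCast_eq_one hc
  have : ‖(D * t ^ 2) ^ 2 + c₁ * (D * t ^ 2) + c₂‖ = ‖(c₂ : ℚ_[p])‖ := by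
    apply norm_eq_of_norm_sub_lt
    rw [hc1, add_sub_cancel_right]
    apply norm_add_lt
    · rw [norm_pow]; exact pow_lt_one₀ (norm_nonneg _) hX two_ne_zero
    · rw [norm_mul]
      exact mul_lt_one_of_nonneg_of_lt_one_right (Padic.norm_int_le_one _) (norm_nonneg _) hX
  have h2 := congrArg norm h
  rw [norm_mul, this, hc1, norm_pow] at h2
  have := eq_zero_of_norm_sq_eq (z := 1) hD (by rw [h2]; simp)
  simp at this

/-- Put `X = D t²`, of odd valuation, so `|X| ≠ |c²|`. If `|X| < |c²|`, the constant term dominates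
and the right side has odd valuation. Otherwise `(u / (D t))² = X + c₁ + c² / X`, with first and
last terms divisible by `p`. -/
theorem isSquare_zmod_of_sq_eq {D t u : ℚ_[p]} (hD : ‖D‖ = (p : ℝ)⁻¹) {c₁ c : ℤ} (hc : c ≠ 0)
    (h : u ^ 2 = D * ((D * t ^ 2) ^ 2 + c₁ * (D * t ^ 2) + (c ^ 2 : ℤ))) :
    IsSquare (c₁ : ZMod p) := by
  have hX := norm_lt_one_of_sq_eq hD h
  have hc' : (c : ℚ_[p]) ≠ 0 := by exact_mod_cast hc
  have hp : (0 : ℝ) < p := by exact_mod_cast (Fact.out : p.Prime).pos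
  have hD0 : D ≠ 0 := by rintro rfl; simp [hp.ne] at hD
  rcases lt_trichotomy ‖D * t ^ 2‖ ‖((c ^ 2 : ℤ) : ℚ_[p])‖ with hlt | heq | hgt
  · exfalso
    have : ‖(D * t ^ 2) ^ 2 + c₁ * (D * t ^ 2) + (c ^ 2 : ℤ)‖ = ‖((c ^ 2 : ℤ) : ℚ_[p])‖ := by
      apply norm_eq_of_norm_sub_lt
      rw [add_sub_cancel_right]
      apply norm_add_lt
      · rw [norm_pow]
        refine lt_of_le_of_lt ?_ hlt
        rw [pow_two]
        exact mul_le_of_le_one_left (norm_nonneg _) hX.le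
      · rw [norm_mul]
        exact (mul_le_of_le_one_left (norm_nonneg _) (Padic.norm_int_le_one _)).trans_lt hlt
    have h2 := congrArg norm h
    rw [norm_mul, this] at h2
    push_cast at h2
    rw [norm_pow, norm_pow] at h2
    exact hc' (eq_zero_of_norm_sq_eq hD h2)
  · exfalso
    push_cast at heq
    rw [norm_mul, norm_pow, norm_pow] at heq
    have := eq_zero_of_norm_sq_eq hD heq.symm
    rw [this] at heq
    simp at heq
    exact hc' (norm_eq_zero.1 (pow_eq_zero_iff two_ne_zero |>.1 heq.symm))
  · have ht : t ≠ 0 := by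
      rintro rfl
      simp at hgt
      exact absurd hgt (not_lt.2 (by positivity))
    have hXpos : 0 < ‖D * t ^ 2‖ := norm_pos_iff.2 (by positivity)
    apply isSquare_zmod_of_norm_sub_lt (y := u / (D * t))
    have : (u / (D * t)) ^ 2 - (c₁ : ℚ_[p]) = D * t ^ 2 + (c ^ 2 : ℤ) / (D * t ^ 2) := by
      rw [div_pow, h]
      field_simp
      ring
    rw [this]
    apply norm_add_lt hX
    rw [norm_div]
    exact (div_lt_one hXpos).2 hgt

/-- If the integral quadratic factor were a unit, the right side would have odd valuation; so it
vanishes mod `p`. -/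
theorem exists_zmod_root_of_sq_eq {D t u : ℚ_[p]} (hD : ‖D‖ = (p : ℝ)⁻¹) {e c₁ c₂ : ℤ}
    (he : ¬ (p : ℤ) ∣ e) (h : u ^ 2 = D * ((e * t ^ 2) ^ 2 + c₁ * (e * t ^ 2) + c₂)) :
    ∃ τ : ZMod p, (e * τ ^ 2) ^ 2 + c₁ * (e * τ ^ 2) + c₂ = 0 := by
  have he1 := norm_intCast_eq_one he
  have hX := norm_le_one_of_sq_eq hD h
  have ht : ‖t‖ ≤ 1 := norm_le_one_of_norm_mul_sq_le
    (by rw [he1]; exact inv_le_one_of_one_le₀ (by exact_mod_cast (Fact.out : p.Prime).one_le)) hX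
  have hq : ‖(e * t ^ 2) ^ 2 + c₁ * (e * t ^ 2) + c₂‖ < 1 := by
    refine lt_of_le_of_ne (norm_quadratic_le_one _ _ hX) fun h1 => ?_
    have h2 := congrArg norm h
    rw [norm_mul, h1, norm_pow] at h2
    have := eq_zero_of_norm_sq_eq (z := 1) hD (by rw [h2]; simp)
    simp at this
  obtain ⟨t, rfl⟩ := exists_padicInt_coe_eq ht
  have h2 : ‖((e : ℤ_[p]) * t ^ 2) ^ 2 + c₁ * (e * t ^ 2) + c₂‖ < 1 := by
    rw [PadicInt.norm_def]; push_cast; exact hq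
  rw [PadicInt.norm_lt_one_iff_dvd, ← Ideal.mem_span_singleton, ← PadicInt.maximalIdeal_eq_span_p,
    ← PadicInt.ker_toZMod, RingHom.mem_ker] at h2
  exact ⟨PadicInt.toZMod t, by simpa using h2⟩

/-- A twist by `-1` with no points over `ℚ_p`. -/
theorem isSquare_neg_zmod_of_sq_eq {t u : ℚ_[p]} {c₁ c₂ : ℤ}
    (h : u ^ 2 = -(t ^ 4 + c₁ * p * t ^ 2 + c₂ * p ^ 2)) :
    IsSquare ((-1 : ℤ) : ZMod p) ∨ IsSquare ((-c₂ : ℤ) : ZMod p) := by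
  have hp : (1 : ℝ) < p := by exact_mod_cast (Fact.out : p.Prime).one_lt
  have hp0 : (p : ℚ_[p]) ≠ 0 := by exact_mod_cast (Fact.out : p.Prime).ne_zero
  have hpi : (p : ℝ)⁻¹ < 1 := inv_lt_one_of_one_lt₀ hp
  have int_mul : ∀ (n : ℤ) (x : ℚ_[p]), ‖(n : ℚ_[p]) * x‖ ≤ ‖x‖ := fun n x => by
    rw [norm_mul]; exact mul_le_of_le_one_left (norm_nonneg _) (Padic.norm_int_le_one _)
  -- When `p` divides `t`, dividing by `p²` gives `(u / p)² ≡ -c₂`; otherwise dividing by `t⁴` gives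
  -- `(u / t²)² ≡ -1`.
  rcases lt_or_ge ‖t‖ 1 with ht | ht
  · right
    have ht' := norm_le_inv_of_lt_one ht
    apply isSquare_zmod_of_norm_sub_lt (y := u / (p : ℚ_[p]))
    have e1 : (u / (p : ℚ_[p])) ^ 2 - ((-c₂ : ℤ) : ℚ_[p]) =
        (-1 : ℤ) * ((t / (p : ℚ_[p])) ^ 2 * t ^ 2) + (-c₁ : ℤ) * ((t / (p : ℚ_[p])) * t) := by
      rw [div_pow, h]
      push_cast
      field_simp
      ring
    have h1 : ‖t / (p : ℚ_[p])‖ ≤ 1 := by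
      rw [norm_div, Padic.norm_p]
      exact (div_le_one (by positivity)).2 ht'
    have h2 : ‖t ^ 2‖ < 1 := by rw [norm_pow]; exact pow_lt_one₀ (norm_nonneg _) ht two_ne_zero
    rw [e1]
    apply norm_add_lt
    · refine (int_mul _ _).trans_lt ?_
      rw [norm_mul, norm_pow (t / _)]
      exact mul_lt_one_of_nonneg_of_lt_one_right (pow_le_one₀ (norm_nonneg _) h1) (norm_nonneg _) h2
    · refine (int_mul _ _).trans_lt ?_
      rw [norm_mul]
      exact mul_lt_one_of_nonneg_of_lt_one_right h1 (norm_nonneg _) ht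
  · left
    have ht0 : t ≠ 0 := by rintro rfl; simp at ht; linarith
    apply isSquare_zmod_of_norm_sub_lt (y := u / t ^ 2)
    have e1 : (u / t ^ 2) ^ 2 - ((-1 : ℤ) : ℚ_[p]) =
        (-c₁ : ℤ) * (p * t⁻¹ ^ 2) + (-c₂ : ℤ) * (p * (p * (t⁻¹ ^ 2) ^ 2)) := by
      rw [div_pow, h]
      push_cast
      field_simp
      ring
    have h1 : ‖t⁻¹ ^ 2‖ ≤ 1 := by
      rw [norm_pow, norm_inv]
      exact pow_le_one₀ (by positivity) (inv_le_one_of_one_le₀ ht)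
    have h2 : ∀ x : ℚ_[p], ‖x‖ ≤ 1 → ‖p * x‖ < 1 := fun x hx => by
      rw [norm_mul, Padic.norm_p]
      exact mul_lt_one_of_nonneg_of_lt_one_left (by positivity) hpi hx
    rw [e1]
    apply norm_add_lt
    · exact (int_mul _ _).trans_lt (h2 _ h1)
    · refine (int_mul _ _).trans_lt (h2 _ (h2 _ ?_).le)
      rw [norm_pow]
      exact pow_le_one₀ (norm_nonneg _) h1

end Padic

/-! ### Obstructions at `2`, by congruences mod `16`. -/

section Dyadic

theorem zmod16_even_or_sq (t : ZMod 16) : t ^ 2 = 0 ∨ t ^ 2 = 4 ∨ t ^ 2 = 1 ∨ t ^ 2 = 9 := by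
  revert t; decide

/-- With `w = u / 2`, the equation is `2 w² = t⁴ - 4 a t² + c²` in `ℤ_2`. The right side is odd for
even `t` and `6` or `14` mod `16` for odd `t`, while `2 w²` is `0`, `2` or `8`. -/
theorem not_exists_dyadic_point_two {a c : ℤ} (ha : a % 2 = 1) (hc : c % 2 = 1) (t u : ℚ_[2]) :
    u ^ 2 ≠ 2 * (t ^ 4 - 4 * a * t ^ 2 + c ^ 2) := by
  intro h
  have hD : ‖(2 : ℚ_[2])‖ = ((2 : ℕ) : ℝ)⁻¹ := by
    have := Padic.norm_p (p := 2)
    exact_mod_cast this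
  have hX : ‖t ^ 2‖ ≤ 1 := norm_le_one_of_sq_eq (c₁ := -4 * a) (c₂ := c ^ 2) hD
    (u := u) (by rw [h]; push_cast; ring)
  have ht : ‖t‖ ≤ 1 := by
    rw [norm_pow] at hX
    exact (pow_le_one_iff_of_nonneg (norm_nonneg _) two_ne_zero).1 hX
  have hw : 2 * (u / 2) ^ 2 = (t ^ 2) ^ 2 + ((-4 * a : ℤ) : ℚ_[2]) * t ^ 2 + (c ^ 2 : ℤ) := by
    rw [div_pow, h]; push_cast; ring
  have hu : ‖u / 2‖ ≤ 1 := by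
    apply norm_le_one_of_norm_mul_sq_le hD.ge
    rw [hw]
    exact norm_quadratic_le_one _ _ hX
  generalize u / 2 = w at hw hu
  obtain ⟨t, rfl⟩ := exists_padicInt_coe_eq ht
  obtain ⟨w, rfl⟩ := exists_padicInt_coe_eq hu
  have h1 : ((2 : ℤ) : ℤ_[2]) * w ^ 2 = (t ^ 2) ^ 2 + ((-4 * a : ℤ) : ℤ_[2]) * t ^ 2 + (c ^ 2 : ℤ) := by
    apply PadicInt.ext
    simp only [PadicInt.coe_mul, PadicInt.coe_add, PadicInt.coe_pow, PadicInt.coe_intCast]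
    simpa using hw
  have h2 := congrArg (PadicInt.toZModPow (p := 2) 4) h1
  simp only [map_mul, map_add, map_pow, map_intCast] at h2
  obtain ⟨a, rfl⟩ : ∃ k, a = 2 * k + 1 := ⟨a / 2, by omega⟩
  obtain ⟨c, rfl⟩ : ∃ k, c = 2 * k + 1 := ⟨c / 2, by omega⟩
  push_cast at h2
  have key : ∀ w t a c : ZMod 16,
      2 * w ^ 2 ≠ (t ^ 2) ^ 2 + -4 * (2 * a + 1) * t ^ 2 + (2 * c + 1) ^ 2 := by
    have hs : ∀ x : ZMod 16, (2 * x + 1) ^ 2 = 1 ∨ (2 * x + 1) ^ 2 = 9 := by decide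
    have ha : ∀ x : ZMod 16, -4 * (2 * x + 1) = 4 ∨ -4 * (2 * x + 1) = 12 := by decide
    intro w t a c
    rcases zmod16_even_or_sq w with h | h | h | h <;> rw [h] <;>
    rcases zmod16_even_or_sq t with h | h | h | h <;> rw [h] <;>
    rcases hs c with h | h <;> rw [h] <;>
    rcases ha a with h | h <;> rw [h] <;> decide
  exact key _ _ _ _ h2

/-- For even `t` the right side is `5` mod `8`. For odd `t` it is `8` mod `16`, of valuation three,
which is why the modulus is `16`. For non-integral `t`, dividing by `t⁴` and writing `t⁻¹ = 2 s`
gives a value that is `3` mod `4`. -/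
theorem not_exists_dyadic_point {A B r : ℤ} (hA : A ≡ 1 [ZMOD 8]) (hB : B ≡ 3 [ZMOD 8])
    (hr : r ≡ 7 [ZMOD 8]) (t u : ℚ_[2]) : u ^ 2 ≠ r * ((t ^ 2 + A) * (t ^ 2 + B)) := by
  intro h
  obtain ⟨A, rfl⟩ := hA.symm.dvd.imp fun k (hk : _ = _) => (eq_add_of_sub_eq hk)
  obtain ⟨B, rfl⟩ := hB.symm.dvd.imp fun k (hk : _ = _) => (eq_add_of_sub_eq hk)
  obtain ⟨r, rfl⟩ := hr.symm.dvd.imp fun k (hk : _ = _) => (eq_add_of_sub_eq hk)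
  have h8 : ∀ x : ZMod 16, 8 * x = 0 ∨ 8 * x = 8 := by decide
  have key : ∀ v x : ZMod 16, (v = 0 ∨ v = 4 ∨ v = 1 ∨ v = 9) → ∀ A B r : ZMod 16,
      (x = 0 ∨ x = 4 ∨ x = 1 ∨ x = 9) →
      v ≠ (8 * r + 7) * ((x + (8 * A + 1)) * (x + (8 * B + 3))) := by
    intro v x hv A B r hx
    rcases hv with rfl | rfl | rfl | rfl <;> rcases hx with rfl | rfl | rfl | rfl <;>
    rcases h8 A with h | h <;> rw [h] <;> rcases h8 B with h | h <;> rw [h] <;>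
    rcases h8 r with h | h <;> rw [h] <;> decide
  have key' : ∀ v x : ZMod 16, (v = 0 ∨ v = 4 ∨ v = 1 ∨ v = 9) → ∀ A B r : ZMod 16,
      (x = 0 ∨ x = 4) →
      v ≠ (8 * r + 7) * ((1 + (8 * A + 1) * x) * (1 + (8 * B + 3) * x)) := by
    intro v x hv A B r hx
    rcases hv with rfl | rfl | rfl | rfl <;> rcases hx with rfl | rfl <;>
    rcases h8 A with h | h <;> rw [h] <;> rcases h8 B with h | h <;> rw [h] <;>
    rcases h8 r with h | h <;> rw [h] <;> decide
  have int_of_sq : ∀ v : ℚ_[2], ∀ z : ℤ_[2], v ^ 2 = z → ‖v‖ ≤ 1 := by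
    intro v z hz
    have : ‖v ^ 2‖ ≤ 1 := by rw [hz]; exact z.2
    rw [norm_pow] at this
    exact (pow_le_one_iff_of_nonneg (norm_nonneg _) two_ne_zero).1 this
  rcases le_or_gt ‖t‖ 1 with ht | ht
  · obtain ⟨t, rfl⟩ := exists_padicInt_coe_eq ht
    have hu := int_of_sq u (((8 * r + 7 : ℤ) : ℤ_[2]) *
      ((t ^ 2 + ((8 * A + 1 : ℤ) : ℤ_[2])) * (t ^ 2 + ((8 * B + 3 : ℤ) : ℤ_[2]))))
      (by simpa only [PadicInt.coe_mul, PadicInt.coe_add, PadicInt.coe_pow, PadicInt.coe_intCast, PadicInt.coe_one] using h)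
    obtain ⟨u, rfl⟩ := exists_padicInt_coe_eq hu
    have h1 : u ^ 2 = ((8 * r + 7 : ℤ) : ℤ_[2]) *
      ((t ^ 2 + ((8 * A + 1 : ℤ) : ℤ_[2])) * (t ^ 2 + ((8 * B + 3 : ℤ) : ℤ_[2]))) := by
      apply PadicInt.ext
      simpa only [PadicInt.coe_mul, PadicInt.coe_add, PadicInt.coe_pow, PadicInt.coe_intCast, PadicInt.coe_one] using h
    have h2 := congrArg (PadicInt.toZModPow (p := 2) 4) h1
    simp only [map_mul, map_add, map_pow, map_intCast] at h2
    push_cast at h2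
    exact key _ _ (zmod16_even_or_sq _) _ _ _ (zmod16_even_or_sq _) h2
  · have ht0 : t ≠ 0 := by rintro rfl; simp at ht; linarith
    have hs : ‖t⁻¹‖ ≤ ((2 : ℕ) : ℝ)⁻¹ :=
      norm_le_inv_of_lt_one (by rw [norm_inv]; exact inv_lt_one_of_one_lt₀ ht)
    have hs' : ‖t⁻¹ / 2‖ ≤ 1 := by
      have h2 := Padic.norm_p (p := 2)
      push_cast at h2 hs
      rw [norm_div, h2]
      exact (div_le_one (by positivity)).2 hs
    have hv : (u * t⁻¹ ^ 2) ^ 2 = ((8 * r + 7 : ℤ) : ℚ_[2]) *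
        ((1 + ((8 * A + 1 : ℤ) : ℚ_[2]) * (((2 : ℤ) : ℚ_[2]) * (t⁻¹ / 2)) ^ 2) *
          (1 + ((8 * B + 3 : ℤ) : ℚ_[2]) * (((2 : ℤ) : ℚ_[2]) * (t⁻¹ / 2)) ^ 2)) := by
      rw [mul_pow, h]
      push_cast
      field_simp
    generalize t⁻¹ / 2 = s at hs' hv
    generalize u * t⁻¹ ^ 2 = v at hv
    obtain ⟨s, rfl⟩ := exists_padicInt_coe_eq hs'
    have hv' := int_of_sq v (((8 * r + 7 : ℤ) : ℤ_[2]) *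
        ((1 + ((8 * A + 1 : ℤ) : ℤ_[2]) * (((2 : ℤ) : ℤ_[2]) * s) ^ 2) *
          (1 + ((8 * B + 3 : ℤ) : ℤ_[2]) * (((2 : ℤ) : ℤ_[2]) * s) ^ 2)))
      (by simpa only [PadicInt.coe_mul, PadicInt.coe_add, PadicInt.coe_pow, PadicInt.coe_intCast, PadicInt.coe_one] using hv)
    obtain ⟨v, rfl⟩ := exists_padicInt_coe_eq hv'
    have h1 : v ^ 2 = ((8 * r + 7 : ℤ) : ℤ_[2]) *
        ((1 + ((8 * A + 1 : ℤ) : ℤ_[2]) * (((2 : ℤ) : ℤ_[2]) * s) ^ 2) *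
          (1 + ((8 * B + 3 : ℤ) : ℤ_[2]) * (((2 : ℤ) : ℤ_[2]) * s) ^ 2)) := by
      apply PadicInt.ext
      simpa only [PadicInt.coe_mul, PadicInt.coe_add, PadicInt.coe_pow, PadicInt.coe_intCast, PadicInt.coe_one] using hv
    have h2 := congrArg (PadicInt.toZModPow (p := 2) 4) h1
    simp only [map_mul, map_add, map_pow, map_intCast, map_one] at h2
    push_cast at h2
    have h4 : ∀ x : ZMod 16, (2 * x) ^ 2 = 0 ∨ (2 * x) ^ 2 = 4 := by decide
    exact key' _ _ (zmod16_even_or_sq _) _ _ _ (h4 _) h2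

theorem not_isSquare_dyadic {r : ℤ} (hr : r ≡ 7 [ZMOD 8]) : ¬ IsSquare (r : ℚ_[2]) := by
  rintro ⟨x, hx⟩
  obtain ⟨r, rfl⟩ := hr.symm.dvd.imp fun k (hk : _ = _) => (eq_add_of_sub_eq hk)
  have hx1 : ‖x‖ ≤ 1 := by
    have h1 := Padic.norm_int_le_one (p := 2) (8 * r + 7)
    rw [hx, ← pow_two, norm_pow] at h1
    exact (pow_le_one_iff_of_nonneg (norm_nonneg _) two_ne_zero).1 h1
  obtain ⟨x, rfl⟩ := exists_padicInt_coe_eq hx1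
  have h1 : ((8 * r + 7 : ℤ) : ℤ_[2]) = x ^ 2 := by
    apply PadicInt.ext
    rw [PadicInt.coe_intCast, hx, PadicInt.coe_pow, pow_two]
  have h2 := congrArg (PadicInt.toZModPow (p := 2) 4) h1
  simp only [map_pow, map_intCast] at h2
  push_cast at h2
  have key : ∀ r x : ZMod 16, 8 * r + 7 ≠ x ^ 2 := by decide
  exact key _ _ h2

end Dyadic

/-! ### Squarefree representatives of rational square classes. -/

section Squarefree

theorem Squarefree.natAbs_dvd_of_primes {D m : ℤ} (hD : Squarefree D)
    (h : ∀ p : ℕ, p.Prime → (p : ℤ) ∣ D → (p : ℤ) ∣ m) : D.natAbs ∣ m.natAbs := by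
  have hD' : Squarefree D.natAbs := Int.squarefree_natAbs.2 hD
  rw [← Nat.prod_primeFactors_of_squarefree hD']
  refine Finset.prod_primes_dvd _ (fun p hp => (Nat.prime_of_mem_primeFactors hp).prime) ?_
  intro p hp
  have := h p (Nat.prime_of_mem_primeFactors hp)
    (Int.natCast_dvd.2 (Nat.dvd_of_mem_primeFactors hp))
  exact Int.natCast_dvd.1 this

theorem exists_squarefree_mul_sq (d : ℚ) (hd : d ≠ 0) :
    ∃ (D : ℤ) (c : ℚ), Squarefree D ∧ c ≠ 0 ∧ d = D * c ^ 2 := by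
  -- Since `d = num * den / den²`, the squarefree part of `|num| * den`, with the sign of `num`,
  -- represents the class.
  obtain ⟨a, b, hab, ha⟩ := Nat.sq_mul_squarefree (d.num.natAbs * d.den)
  have hden : (d.den : ℚ) ≠ 0 := by exact_mod_cast d.den_nz
  have hne : d.num.natAbs * d.den ≠ 0 :=
    mul_ne_zero (Int.natAbs_ne_zero.2 (Rat.num_ne_zero.2 hd)) d.den_nz
  have hb : (b : ℚ) ≠ 0 := by
    have : b ≠ 0 := by rintro rfl; simp at hab; exact hd hab
    exact_mod_cast this
  have key : ∀ s : ℤ, d.num = s * d.num.natAbs → (d = ((s * a : ℤ) : ℚ) * ((b : ℚ) / d.den) ^ 2) := by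
    intro s hs
    have h1 : (d.num : ℚ) = s * (d.num.natAbs : ℚ) := by
      conv_lhs => rw [hs]
      rw [Int.cast_mul, Int.cast_natCast]
    have h2 : (b : ℚ) ^ 2 * a = d.num.natAbs * d.den := by exact_mod_cast hab
    conv_lhs => rw [← Rat.num_div_den d]
    push_cast
    field_simp
    rw [h1]
    linear_combination (-(s : ℚ)) * h2
  have ha' : Squarefree (a : ℤ) := Int.squarefree_natCast.2 ha
  rcases Int.natAbs_eq d.num with h | h
  · exact ⟨1 * a, b / d.den, by simpa using ha', div_ne_zero hb hden, key 1 (by rw [one_mul]; exact h)⟩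
  · refine ⟨-1 * a, b / d.den, ?_, div_ne_zero hb hden, key (-1) (by rw [neg_one_mul]; exact h)⟩
    rw [← Int.squarefree_natAbs] at ha' ⊢
    simpa using ha'

end Squarefree

/-! ### Passing between Selmer classes and torsor points. -/

section Selmer

theorem torsorHasPoint_of_mem_selmerLift {a b : ℤ} (hb : b ≠ 0) {d : ℚˣ}
    (hd : d ∈ selmerLift a b) {e c : ℚ} (hdc : (d : ℚ) = e * c ^ 2) :
    (∀ (p : ℕ) [Fact p.Prime], TorsorHasPoint (a : ℚ_[p]) (b : ℚ_[p]) (e : ℚ_[p])) ∧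
      TorsorHasPoint (a : ℝ) (b : ℝ) (e : ℝ) := by
  have hd0 : e * c ^ 2 ≠ 0 := hdc ▸ d.ne_zero
  have hc : c ≠ 0 := fun h => hd0 (by rw [h]; ring)
  refine ⟨fun p _ => ?_, ?_⟩
  · have := (hd.1 p).torsorHasPoint (by exact_mod_cast hb) (by exact_mod_cast d.ne_zero)
    rw [hdc] at this
    push_cast at this
    exact this.of_mul_sq (by exact_mod_cast hc)
  · have := hd.2.torsorHasPoint (by exact_mod_cast hb) (by exact_mod_cast d.ne_zero)
    rw [hdc] at this
    push_cast at this
    exact this.of_mul_sq (by exact_mod_cast hc)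

/-- A rational point of the torsor is a local point at every place; this is how classes are shown to
lie in the Selmer group. -/
theorem mem_selmerLift_of_torsor {a b : ℚ} (hb : b ≠ 0) (d : ℚˣ) {t u : ℚ} (ht : t ≠ 0)
    (h : u ^ 2 = d * ((d * t ^ 2 - a) ^ 2 - 4 * b)) : d ∈ selmerLift a b := by
  have key : ∀ {L : Type} [Field L] [CharZero L],
      TrivialInH1 ((a : ℚ) : L) ((b : ℚ) : L) (((d : ℚ) : L)) := by
    intro L _ _
    refine trivialInH1_of_torsor (t := (t : L)) (u := (u : L)) (by exact_mod_cast hb)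
      (by exact_mod_cast d.ne_zero) (by exact_mod_cast ht) ?_
    have := congrArg (fun x : ℚ => (x : L)) h
    push_cast at this
    exact this
  exact ⟨fun p _ => key, key⟩

theorem exists_sq_eq_of_dvd {a b D : ℤ} {p : ℕ} [Fact p.Prime] (hD : Squarefree D)
    (hp : (p : ℤ) ∣ D) (h : TorsorHasPoint (a : ℚ_[p]) (b : ℚ_[p]) (D : ℚ_[p])) :
    ∃ t u : ℚ_[p], u ^ 2 = D * ((D * t ^ 2) ^ 2 + (-2 * a : ℤ) * (D * t ^ 2) +
      (a ^ 2 - 4 * b : ℤ)) := by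
  rcases h with ⟨x, hx⟩ | ⟨t, u, h⟩
  · have h1 := congrArg norm hx
    rw [norm_mul, ← pow_two] at h1
    have := eq_zero_of_norm_sq_eq (z := 1) (norm_intCast_of_squarefree hD hp)
      (by rw [← h1]; simp)
    simp at this
  · exact ⟨t, u, by rw [h]; push_cast; ring⟩

end Selmer

/-! ### Local exclusions for the two isogenies. -/

/-- The arithmetic hypotheses on the primes `|A|`, `|B|` and the twisting prime `r`. -/
structure TwistHypotheses (A B : ℤ) (r : ℕ) [Fact r.Prime] : Prop where
  prime_A : A.natAbs.Prime
  prime_B : B.natAbs.Prime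
  A_mod : A ≡ 1 [ZMOD 8]
  B_mod : B ≡ 3 [ZMOD 8]
  sign : 0 ≤ A + B ∨ A * B < 0
  coprime : IsCoprime (r : ℤ) (A * B * (A - B))
  r_mod : r ≡ 7 [MOD 8]
  legendre_A : legendreSym r A = -1
  legendre_B : legendreSym r B = -1
  legendre_sub : ∀ (p : ℕ) [Fact p.Prime], p ≠ 2 → (p : ℤ) ∣ A - B → legendreSym p (-B * r) = -1

namespace TwistHypotheses

variable {A B : ℤ} {r : ℕ} [hr : Fact r.Prime]

theorem A_ne_zero (h : TwistHypotheses A B r) : A ≠ 0 := by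
  rintro rfl; exact Nat.not_prime_zero h.prime_A

theorem B_ne_zero (h : TwistHypotheses A B r) : B ≠ 0 := by
  rintro rfl; exact Nat.not_prime_zero h.prime_B

theorem r_ne_zero (_ : TwistHypotheses A B r) : (r : ℤ) ≠ 0 := by
  exact_mod_cast hr.out.ne_zero

theorem sub_ne_zero (h : TwistHypotheses A B r) : A - B ≠ 0 := by
  have h1 := h.A_mod
  have h2 := h.B_mod
  unfold Int.ModEq at h1 h2
  omega

theorem not_dvd (h : TwistHypotheses A B r) : ¬ (r : ℤ) ∣ A * B * (A - B) := by
  intro hd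
  have := h.coprime.isUnit_of_dvd' dvd_rfl hd
  exact (Nat.prime_iff_prime_int.1 hr.out).not_isUnit this

theorem A_zmod_ne_zero (h : TwistHypotheses A B r) : (A : ZMod r) ≠ 0 := by
  rw [Ne, ZMod.intCast_zmod_eq_zero_iff_dvd]
  exact fun hd => h.not_dvd (dvd_mul_of_dvd_left (dvd_mul_of_dvd_left hd _) _)

theorem B_zmod_ne_zero (h : TwistHypotheses A B r) : (B : ZMod r) ≠ 0 := by
  rw [Ne, ZMod.intCast_zmod_eq_zero_iff_dvd]
  exact fun hd => h.not_dvd (dvd_mul_of_dvd_left (dvd_mul_of_dvd_right hd _) _)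

theorem sub_zmod_ne_zero (h : TwistHypotheses A B r) : (A : ZMod r) - B ≠ 0 := by
  rw [← Int.cast_sub, Ne, ZMod.intCast_zmod_eq_zero_iff_dvd]
  exact fun hd => h.not_dvd (dvd_mul_of_dvd_right hd _)

theorem r_mod_eight (h : TwistHypotheses A B r) : r % 8 = 7 := h.r_mod

theorem not_isSquare_neg_one (h : TwistHypotheses A B r) : ¬ IsSquare (-1 : ZMod r) := by
  rw [ZMod.exists_sq_eq_neg_one_iff]
  have := h.r_mod_eight
  omega

theorem isSquare_two (h : TwistHypotheses A B r) : IsSquare (2 : ZMod r) := by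
  have := h.r_mod_eight
  rw [ZMod.exists_sq_eq_two_iff (by omega)]
  omega

theorem not_isSquare_A (h : TwistHypotheses A B r) : ¬ IsSquare (A : ZMod r) :=
  (legendreSym.eq_neg_one_iff r).1 h.legendre_A

theorem not_isSquare_B (h : TwistHypotheses A B r) : ¬ IsSquare (B : ZMod r) :=
  (legendreSym.eq_neg_one_iff r).1 h.legendre_B

theorem isSquare_neg_of_not_isSquare (h : TwistHypotheses A B r) {n : ℤ}
    (hn : ¬ IsSquare (n : ZMod r)) : ∃ x : ZMod r, -(n : ZMod r) = x ^ 2 := by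
  have hn0 : (n : ZMod r) ≠ 0 := fun h0 => hn (by rw [h0]; exact IsSquare.zero)
  have h1 : legendreSym r n = -1 := (legendreSym.eq_neg_one_iff r).2 hn
  have h2 : legendreSym r (-1) = -1 :=
    (legendreSym.eq_neg_one_iff r).2 (by push_cast; exact h.not_isSquare_neg_one)
  have h3 : legendreSym r (-n) = 1 := by
    rw [← neg_one_mul, legendreSym.mul, h1, h2]; norm_num
  obtain ⟨x, hx⟩ := (legendreSym.eq_one_iff r (by push_cast; simpa using hn0)).1 h3
  exact ⟨x, by rw [pow_two, ← hx]; push_cast; rfl⟩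

theorem eq_zero_of_sq_add_sq (h : TwistHypotheses A B r) {x y : ZMod r}
    (hxy : x ^ 2 + y ^ 2 = 0) : x = 0 ∧ y = 0 := by
  have hx : x = 0 := by
    by_contra hx
    refine h.not_isSquare_neg_one ⟨y / x, ?_⟩
    field_simp
    linear_combination -hxy
  subst hx
  exact ⟨rfl, by simpa using hxy⟩

/-- The quadratic polynomial whose roots are the `X`-coordinates of the nontrivial `2`-torsion
points on the dual of `E^{A,B}` represents `0` modulo `r` at no square. -/
theorem no_square_root (h : TwistHypotheses A B r) (τ : ZMod r) :
    (τ ^ 2) ^ 2 - 2 * (A + B) * τ ^ 2 + (A - B) ^ 2 ≠ 0 := by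
  intro h0
  obtain ⟨α, hα⟩ := h.isSquare_neg_of_not_isSquare h.not_isSquare_A
  obtain ⟨β, hβ⟩ := h.isSquare_neg_of_not_isSquare h.not_isSquare_B
  have hA : (A : ZMod r) = -α ^ 2 := by rw [← hα, neg_neg]
  have hB : (B : ZMod r) = -β ^ 2 := by rw [← hβ, neg_neg]
  -- With `A = -α²` and `B = -β²` mod `r`, the quadratic splits into sums of two squares. As `-1` is
  -- a nonresidue, a vanishing factor forces `α = ±β`, hence `A = B` mod `r`.
  have hf : (τ ^ 2 + (α - β) ^ 2) * (τ ^ 2 + (α + β) ^ 2) = 0 := by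
    rw [hA, hB] at h0; linear_combination h0
  apply h.sub_zmod_ne_zero
  rw [hA, hB]
  rcases mul_eq_zero.1 hf with h1 | h1
  · linear_combination (-α - β) * (h.eq_zero_of_sq_add_sq h1).2
  · linear_combination (-α + β) * (h.eq_zero_of_sq_add_sq h1).2

/-- Any other prime `p` would divide the constant term `((A - B) r)²`, hence `A - B`. The middle
coefficient `-2 (A + B) r ≡ -4 B r` would then be a square mod `p`, contradicting `legendre_sub`. -/
theorem eq_two_or_eq_of_dvd (h : TwistHypotheses A B r) {D : ℤ} (hD : Squarefree D) {p : ℕ}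
    [hp : Fact p.Prime] (hpD : (p : ℤ) ∣ D)
    (hT : TorsorHasPoint (((A + B) * r : ℤ) : ℚ_[p]) ((A * B * r ^ 2 : ℤ) : ℚ_[p]) (D : ℚ_[p])) :
    p = 2 ∨ p = r := by
  by_contra! hne
  obtain ⟨t, u, htu⟩ := exists_sq_eq_of_dvd hD hpD hT
  have hn := norm_intCast_of_squarefree hD hpD
  have hpp := Nat.prime_iff_prime_int.1 hp.out
  rw [show ((A + B) * r) ^ 2 - 4 * (A * B * (r : ℤ) ^ 2) = ((A - B) * r) ^ 2 by ring] at htu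
  have hdvd : (p : ℤ) ∣ A - B := by
    rcases hpp.dvd_or_dvd (hpp.dvd_of_dvd_pow (dvd_of_sq_eq hn htu)) with h1 | h1
    · exact h1
    · exact absurd ((Nat.prime_dvd_prime_iff_eq hp.out hr.out).1 (by exact_mod_cast h1)) hne.2
  have hsq := isSquare_zmod_of_sq_eq hn (mul_ne_zero h.sub_ne_zero h.r_ne_zero) htu
  apply (legendreSym.eq_neg_one_iff p).1 (h.legendre_sub p hne.1 hdvd)
  have h2 : (2 : ZMod p) ≠ 0 := by
    have : ((2 : ℕ) : ZMod p) ≠ 0 := by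
      rw [Ne, ZMod.natCast_eq_zero_iff]
      exact fun h2 => hne.1 ((Nat.prime_dvd_prime_iff_eq hp.out Nat.prime_two).1 h2)
    exact_mod_cast this
  have hAB : (A : ZMod p) = B := by
    rw [← ZMod.intCast_zmod_eq_zero_iff_dvd, Int.cast_sub] at hdvd
    exact sub_eq_zero.1 hdvd
  obtain ⟨x, hx⟩ := hsq
  refine ⟨x / 2, ?_⟩
  push_cast at hx ⊢
  rw [hAB] at hx
  field_simp
  linear_combination hx

/-- The `φ`-descent: the only squarefree integer whose torsor has points everywhere locally is
`1`. -/
theorem eq_one_of_torsorHasPoint (h : TwistHypotheses A B r) {D : ℤ} (hD : Squarefree D)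
    (hT : ∀ (p : ℕ) [Fact p.Prime], TorsorHasPoint (((A + B) * r : ℤ) : ℚ_[p])
      ((A * B * r ^ 2 : ℤ) : ℚ_[p]) (D : ℚ_[p]))
    (hTR : TorsorHasPoint (((A + B) * r : ℤ) : ℝ) ((A * B * r ^ 2 : ℤ) : ℝ) (D : ℝ)) :
    D = 1 := by
  have hr0 : (0 : ℝ) < r := by exact_mod_cast hr.out.pos
  have hAB0 : (A - B : ℝ) ≠ 0 := by exact_mod_cast h.sub_ne_zero
  have hpos : 0 < D := by
    rcases lt_trichotomy D 0 with hneg | h0 | hpos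
    · exfalso
      have hneg' : (D : ℝ) < 0 := by exact_mod_cast hneg
      rcases hTR with ⟨x, hx⟩ | ⟨t, u, htu⟩
      · nlinarith [mul_self_nonneg x]
      · push_cast at htu
        -- If `A + B ≥ 0` and `D < 0`, the first square is at least `((A + B) r)²`, which exceeds `4
        -- A B r²` since `A ≠ B`; if `A B < 0`, positivity is immediate. The right side is then
        -- negative, so it is no square.
        have hbr : 0 < (D * t ^ 2 - (A + B) * r) ^ 2 - 4 * (A * B * r ^ 2 : ℝ) := by
          rcases h.sign with hs | hs
          · have hs' : (0 : ℝ) ≤ A + B := by exact_mod_cast hs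
            have h1 : 0 ≤ -D * t ^ 2 := by nlinarith [sq_nonneg t]
            have h2 : 0 ≤ (A + B) * (r : ℝ) := by positivity
            have h3 : 0 < ((A - B) * (r : ℝ)) ^ 2 := by positivity
            nlinarith [mul_nonneg h1 h2]
          · have hs' : (A * B : ℝ) < 0 := by exact_mod_cast hs
            have h3 : A * B * (r : ℝ) ^ 2 < 0 := by
              have : 0 < (r : ℝ) ^ 2 := by positivity
              nlinarith
            nlinarith [sq_nonneg (D * t ^ 2 - (A + B) * (r : ℝ))]
        nlinarith [sq_nonneg u]
    · subst h0
      exact absurd hD not_squarefree_zero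
    · exact hpos
  have hpr : ∀ p : ℕ, p.Prime → (p : ℤ) ∣ D → p = 2 ∨ p = r := fun p hp hpD =>
    haveI := Fact.mk hp
    h.eq_two_or_eq_of_dvd hD hpD (hT p)
  have le_two : ∀ e : ℤ, 0 < e → Squarefree e → (∀ p : ℕ, p.Prime → (p : ℤ) ∣ e → p = 2) →
      e = 1 ∨ e = 2 := by
    intro e he hsq hp
    have h1 := Squarefree.natAbs_dvd_of_primes (m := 2) hsq fun p hp' hpe => by
      rw [hp p hp' hpe]; rfl
    have := Nat.le_of_dvd (by norm_num) h1
    norm_num at this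
    omega
  have hrD : ¬ (r : ℤ) ∣ D := by
    intro hrD
    obtain ⟨t, u, htu⟩ := exists_sq_eq_of_dvd hD hrD (hT r)
    have hn := norm_intCast_of_squarefree hD hrD
    obtain ⟨e, rfl⟩ := hrD
    have hre : ¬ (r : ℤ) ∣ e := fun hre =>
      (Nat.prime_iff_prime_int.1 hr.out).not_isUnit (hD r (mul_dvd_mul_left _ hre))
    have he := le_two e (pos_of_mul_pos_right hpos (by positivity)) (hD.of_mul_right)
      fun p hp hpe => (hpr p hp (dvd_mul_of_dvd_right hpe _)).resolve_right
        (by rintro rfl; exact hre hpe)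
    have hr0' : (r : ℚ_[r]) ≠ 0 := by exact_mod_cast hr.out.ne_zero
    obtain ⟨τ, hτ⟩ := exists_zmod_root_of_sq_eq (t := t) (u := u / (r : ℚ_[r])) hn hre
      (c₁ := -2 * (A + B)) (c₂ := (A - B) ^ 2) (by
        rw [div_pow, htu]; push_cast; field_simp; ring)
    -- The cofactor `e` is `1` or `2`, a square mod `r` because `r ≡ 7` mod `8`, so it can be
    -- absorbed into `τ`.
    obtain ⟨ε, hε⟩ : ∃ ε : ZMod r, (e : ZMod r) = ε ^ 2 := by
      rcases he with rfl | rfl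
      · exact ⟨1, by simp⟩
      · obtain ⟨x, hx⟩ := h.isSquare_two
        exact ⟨x, by push_cast; rw [hx, pow_two]⟩
    apply h.no_square_root (ε * τ)
    rw [hε] at hτ
    push_cast at hτ
    linear_combination hτ
  rcases le_two D hpos hD fun p hp hpD => (hpr p hp hpD).resolve_right
    (by rintro rfl; exact hrD hpD) with h1 | rfl
  · exact h1
  exfalso
  obtain ⟨t, u, htu⟩ := exists_sq_eq_of_dvd hD (p := 2) (by norm_num) (hT 2)
  have h1 := h.A_mod
  have h2 := h.B_mod
  have h3 := h.r_mod_eight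
  unfold Int.ModEq at h1 h2
  -- From `A + B ≡ 4` and `A - B ≡ 6` mod `8`, both `s` and `c` are odd, as the dyadic obstruction
  -- requires.
  obtain ⟨s, hs⟩ : ∃ s, A + B = 4 * s := ⟨(A + B) / 4, by omega⟩
  obtain ⟨c, hc⟩ : ∃ c, A - B = 2 * c := ⟨(A - B) / 2, by omega⟩
  have hs1 : s % 2 = 1 := by omega
  have hc1 : c % 2 = 1 := by omega
  have hr1 : (r : ℤ) % 2 = 1 := by omega
  apply not_exists_dyadic_point_two (a := s * r) (c := c * r)
    (by rw [Int.mul_emod, hs1, hr1]; rfl) (by rw [Int.mul_emod, hc1, hr1]; rfl) t (u / 2)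
  rw [show ((A + B) * r) ^ 2 - 4 * (A * B * (r : ℤ) ^ 2) = ((A - B) * r) ^ 2 by ring, hs, hc] at htu
  rw [div_pow, htu]
  push_cast
  ring

/-- Points on the torsor of the dual curve, in terms of the equation of `E` itself. -/
theorem exists_sq_eq_dual {L : Type*} [Field L] [CharZero L] {d : L} {n : ℤ} {A B : ℤ}
    (h : TorsorHasPoint ((-2 * ((A + B) * n) : ℤ) : L) (((A - B) ^ 2 * n ^ 2 : ℤ) : L) d) :
    IsSquare d ∨ ∃ t u : L, u ^ 2 = d * ((d * t ^ 2) ^ 2 + ((A + B) * n : ℤ) * (d * t ^ 2) +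
      (A * B * n ^ 2 : ℤ)) := by
  rcases h with h | ⟨t, u, htu⟩
  · exact Or.inl h
  · refine Or.inr ⟨t / 2, u / 4, ?_⟩
    rw [div_pow, htu]
    push_cast
    ring

theorem dvd_of_dual_torsorHasPoint {D n : ℤ} (hD : Squarefree D) {p : ℕ}
    [hp : Fact p.Prime] (hpD : (p : ℤ) ∣ D)
    (hT : TorsorHasPoint ((-2 * ((A + B) * n) : ℤ) : ℚ_[p]) (((A - B) ^ 2 * n ^ 2 : ℤ) : ℚ_[p])
      (D : ℚ_[p])) :
    (p : ℤ) ∣ A * B * n := by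
  have hn := norm_intCast_of_squarefree hD hpD
  rcases exists_sq_eq_dual hT with ⟨x, hx⟩ | ⟨t, u, htu⟩
  · have h1 := congrArg norm hx
    rw [norm_mul, ← pow_two] at h1
    have := eq_zero_of_norm_sq_eq (z := 1) hn (by rw [← h1]; simp)
    simp at this
  · have hpp := Nat.prime_iff_prime_int.1 hp.out
    have := dvd_of_sq_eq hn htu
    rw [show A * B * n ^ 2 = A * B * n * n by ring] at this
    rcases hpp.dvd_or_dvd this with h1 | h1
    · exact h1
    · exact dvd_mul_of_dvd_right h1 _

theorem not_isSquare_padic_of_norm {p : ℕ} [Fact p.Prime] {D : ℚ_[p]}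
    (hD : ‖D‖ = (p : ℝ)⁻¹) : ¬ IsSquare D := by
  rintro ⟨x, hx⟩
  have h1 := congrArg norm hx
  rw [norm_mul, ← pow_two] at h1
  have := eq_zero_of_norm_sq_eq (z := 1) hD (by rw [← h1]; simp)
  simp at this

/-- A point would make `-1` or `-A B` a square mod `r`. But `A B` is a product of two nonresidues,
hence a residue, while `-1` is not. -/
theorem not_dual_torsorHasPoint_neg_one (h : TwistHypotheses A B r) :
    ¬ TorsorHasPoint ((-2 * ((A + B) * r) : ℤ) : ℚ_[r]) (((A - B) ^ 2 * r ^ 2 : ℤ) : ℚ_[r])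
      (-1) := by
  intro hT
  rcases exists_sq_eq_dual hT with ⟨x, hx⟩ | ⟨t, u, htu⟩
  · apply h.not_isSquare_neg_one
    have := isSquare_zmod_of_norm_sub_lt (p := r) (y := x) (n := -1) (by
      rw [pow_two, ← hx]; simp)
    simpa using this
  · rcases isSquare_neg_zmod_of_sq_eq (p := r) (t := t) (u := u) (c₁ := -(A + B)) (c₂ := A * B)
      (by rw [htu]; push_cast; ring) with h1 | h1
    · exact h.not_isSquare_neg_one (by simpa using h1)
    · obtain ⟨α, hα⟩ := h.isSquare_neg_of_not_isSquare h.not_isSquare_A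
      obtain ⟨β, hβ⟩ := h.isSquare_neg_of_not_isSquare h.not_isSquare_B
      have hA0 := h.A_zmod_ne_zero
      have hB0 := h.B_zmod_ne_zero
      obtain ⟨x, hx⟩ := h1
      push_cast at hx
      have hαβ : (A : ZMod r) * B = (α * β) ^ 2 := by rw [mul_pow, ← hα, ← hβ]; ring
      have h0 : (x ^ 2 + (α * β) ^ 2 : ZMod r) = 0 := by linear_combination -hx - hαβ
      have := (h.eq_zero_of_sq_add_sq h0).2
      rw [this] at hαβ
      exact mul_ne_zero hA0 hB0 (by simpa using hαβ)

/-- After division by `r²` the torsor is `u² = -r (t² - A) (t² - B)`, so a point would make `A` or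
`B` a residue mod `r`. -/
theorem not_dual_torsorHasPoint_neg (h : TwistHypotheses A B r) :
    ¬ TorsorHasPoint ((-2 * ((A + B) * r) : ℤ) : ℚ_[r]) (((A - B) ^ 2 * r ^ 2 : ℤ) : ℚ_[r])
      (-r) := by
  intro hT
  have hn : ‖(-r : ℚ_[r])‖ = (r : ℝ)⁻¹ := by rw [norm_neg, Padic.norm_p]
  have hr0' : (r : ℚ_[r]) ≠ 0 := by exact_mod_cast hr.out.ne_zero
  rcases exists_sq_eq_dual hT with h1 | ⟨t, u, htu⟩
  · exact not_isSquare_padic_of_norm hn h1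
  · obtain ⟨τ, hτ⟩ := exists_zmod_root_of_sq_eq (t := t) (u := u / (r : ℚ_[r])) hn (e := 1)
      (c₁ := -(A + B)) (c₂ := A * B)
      (by exact_mod_cast hr.out.not_dvd_one)
      (by rw [div_pow, htu]; push_cast; field_simp)
    have : (τ ^ 2 - A) * (τ ^ 2 - B) = 0 := by push_cast at hτ; linear_combination hτ
    rcases mul_eq_zero.1 this with h1 | h1
    · exact h.not_isSquare_A ⟨τ, by linear_combination -h1⟩
    · exact h.not_isSquare_B ⟨τ, by linear_combination -h1⟩

theorem not_dual_torsorHasPoint_self (h : TwistHypotheses A B r) :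
    ¬ TorsorHasPoint ((-2 * ((A + B) * r) : ℤ) : ℚ_[2]) (((A - B) ^ 2 * r ^ 2 : ℤ) : ℚ_[2])
      r := by
  intro hT
  have hr8 : (r : ℤ) ≡ 7 [ZMOD 8] := by exact_mod_cast (Int.natCast_modEq_iff.2 h.r_mod)
  have hr0' : (r : ℚ_[2]) ≠ 0 := by exact_mod_cast hr.out.ne_zero
  rcases exists_sq_eq_dual hT with ⟨x, hx⟩ | ⟨t, u, htu⟩
  · exact not_isSquare_dyadic hr8 ⟨x, by rw [← hx, Int.cast_natCast]⟩
  · apply not_exists_dyadic_point h.A_mod h.B_mod hr8 t (u / r)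
    rw [div_pow, htu]
    push_cast
    field_simp
    ring

end TwistHypotheses

/-! ### A criterion for Klein four-groups. -/

section KleinFour

theorem isKleinFour_of_forall_mem_iff {G : Type*} [CommGroup G] (hG : ∀ x : G, x ^ 2 = 1)
    (S : Subgroup G) {α β : G} (hα : α ≠ 1) (hβ : β ≠ 1) (hαβ : α * β ≠ 1)
    (hS : ∀ x, x ∈ S ↔ x = 1 ∨ x = α ∨ x = β ∨ x = α * β) : IsKleinFour S := by
  have hne : α ≠ β := by
    rintro rfl
    exact hαβ (by rw [← pow_two, hG])
  have hset : (S : Set G) = {1, α, β, α * β} := by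
    ext x
    simpa using hS x
  constructor
  · change Nat.card (S : Set G) = 4
    rw [Nat.card_coe_set_eq, hset, Set.ncard_insert_of_notMem, Set.ncard_insert_of_notMem,
      Set.ncard_pair]
    · simpa using hα
    · simpa using ⟨hne, hβ⟩
    · simpa using ⟨hα.symm, hβ.symm, hαβ.symm⟩
  · have : Nontrivial S := ⟨⟨⟨α, (hS α).2 (by simp)⟩, 1, fun h => hα (congrArg Subtype.val h)⟩⟩
    rw [Monoid.exponent_eq_prime_iff Nat.prime_two]
    intro g hg
    exact orderOf_eq_prime (Subtype.ext (hG g)) hg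

end KleinFour

/-! ### The group of rational square classes. -/

section SquareClasses

theorem squareClass_eq_one_iff (d : ℚˣ) :
    (QuotientGroup.mk' (powMonoidHom 2 : ℚˣ →* ℚˣ).range d) = 1 ↔ IsSquare (d : ℚ) := by
  rw [QuotientGroup.mk'_apply, QuotientGroup.eq_one_iff]
  constructor
  · rintro ⟨c, rfl⟩
    exact ⟨c, by simp [pow_two]⟩
  · rintro ⟨c, hc⟩
    have hc0 : c ≠ 0 := by rintro rfl; simp at hc
    exact ⟨Units.mk0 c hc0, Units.ext (by simp [pow_two, hc])⟩

theorem squareClass_sq (x : ℚˣ ⧸ (powMonoidHom 2 : ℚˣ →* ℚˣ).range) : x ^ 2 = 1 := by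
  obtain ⟨d, rfl⟩ := QuotientGroup.mk'_surjective _ x
  rw [← map_pow, squareClass_eq_one_iff]
  exact ⟨d, by simp [pow_two]⟩

theorem squareClass_eq_iff (d e : ℚˣ) : QuotientGroup.mk' (powMonoidHom 2 : ℚˣ →* ℚˣ).range d =
    QuotientGroup.mk' (powMonoidHom 2 : ℚˣ →* ℚˣ).range e ↔ IsSquare ((e * d : ℚˣ) : ℚ) := by
  rw [← squareClass_eq_one_iff, map_mul]
  have h := squareClass_sq (QuotientGroup.mk' (powMonoidHom 2 : ℚˣ →* ℚˣ).range e)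
  constructor
  · rintro h1
    rw [h1, ← pow_two, h]
  · intro h1
    rw [pow_two] at h
    exact mul_left_cancel (h1.trans h.symm)

theorem not_isSquare_prime_mul {p : ℕ} (hp : p.Prime) {m : ℤ} (hm : ¬ (p : ℤ) ∣ m) :
    ¬ IsSquare ((p : ℤ) * m) := by
  rintro ⟨x, hx⟩
  have hpp := Nat.prime_iff_prime_int.1 hp
  obtain ⟨y, rfl⟩ : (p : ℤ) ∣ x := by
    have : (p : ℤ) ∣ x * x := hx ▸ dvd_mul_right _ _
    rcases hpp.dvd_or_dvd this with h | h <;> exact h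
  apply hm
  refine ⟨y * y, mul_left_cancel₀ hpp.ne_zero ?_⟩
  linear_combination hx

end SquareClasses

/-! ### The two Selmer groups. -/

namespace TwistHypotheses

variable {A B : ℤ} {r : ℕ} [hr : Fact r.Prime]

theorem natAbs_ne (h : TwistHypotheses A B r) : A.natAbs ≠ B.natAbs := by
  have h1 := h.A_mod
  have h2 := h.B_mod
  unfold Int.ModEq at h1 h2
  omega

theorem natAbs_A_ne (h : TwistHypotheses A B r) : A.natAbs ≠ r := by
  intro he
  apply h.not_dvd
  rw [← he]
  exact dvd_mul_of_dvd_left (dvd_mul_of_dvd_left (Int.natAbs_dvd.2 dvd_rfl) _) _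

theorem isSquare_of_mem_selmerLift (h : TwistHypotheses A B r) {d : ℚˣ}
    (hd : d ∈ selmerLift ((A + B) * r : ℤ) (A * B * r ^ 2 : ℤ)) : IsSquare (d : ℚ) := by
  obtain ⟨D, c, hD, -, hdc⟩ := exists_squarefree_mul_sq d d.ne_zero
  have hT := torsorHasPoint_of_mem_selmerLift
    (mul_ne_zero (mul_ne_zero h.A_ne_zero h.B_ne_zero) (pow_ne_zero 2 h.r_ne_zero)) hd hdc
  simp only [Rat.cast_intCast] at hT
  rw [hdc, h.eq_one_of_torsorHasPoint hD hT.1 hT.2]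
  exact ⟨c, by push_cast; ring⟩

/-- The lift to `ℚˣ` of the Selmer group of the dual isogeny. -/
abbrev dualLift (A B : ℤ) (r : ℕ) : Subgroup ℚˣ :=
  selmerLift (-2 * ((A + B) * r) : ℤ) ((A - B) ^ 2 * r ^ 2 : ℤ)

/-- This is the connecting map `(x, y) ↦ x`. At `t = 2` the difference of squares in the torsor
factors as `4 (x + A r) * 4 (x + B r)`, whence `u = 4 y`. -/
theorem mem_dualLift_of_point (h : TwistHypotheses A B r) (d : ℚˣ) {y : ℚ}
    (hy : y ^ 2 = d * (d + A * r) * (d + B * r)) : d ∈ dualLift A B r := by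
  refine mem_selmerLift_of_torsor (t := 2) (u := 4 * y) ?_ d two_ne_zero ?_
  · exact_mod_cast mul_ne_zero (pow_ne_zero 2 h.sub_ne_zero) (pow_ne_zero 2 h.r_ne_zero)
  · push_cast
    linear_combination 16 * hy

theorem isSquare_of_mem_dualLift (h : TwistHypotheses A B r) {d : ℚˣ} (hd : d ∈ dualLift A B r)
    {c : ℚ} {e : ℤ} (he : e = 1 ∨ e = -1 ∨ e = r ∨ e = -r) (hdc : (d : ℚ) = e * c ^ 2) :
    IsSquare (d : ℚ) := by
  have hT := (torsorHasPoint_of_mem_selmerLift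
    (mul_ne_zero (pow_ne_zero 2 h.sub_ne_zero) (pow_ne_zero 2 h.r_ne_zero)) hd hdc).1
  simp only [Rat.cast_intCast] at hT
  rcases he with rfl | rfl | rfl | rfl
  · exact ⟨c, by rw [hdc]; push_cast; ring⟩
  · exact absurd (by simpa using hT r) h.not_dual_torsorHasPoint_neg_one
  · exact absurd (by simpa using hT 2) h.not_dual_torsorHasPoint_self
  · exact absurd (by simpa using hT r) h.not_dual_torsorHasPoint_neg

/-- The class of the `2`-torsion point `(-A r, 0)`. -/
def unitA (h : TwistHypotheses A B r) : ℚˣ :=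
  Units.mk0 (-A * r) (mul_ne_zero (neg_ne_zero.2 (by exact_mod_cast h.A_ne_zero))
    (by exact_mod_cast hr.out.ne_zero))

/-- The class of the `2`-torsion point `(-B r, 0)`. -/
def unitB (h : TwistHypotheses A B r) : ℚˣ :=
  Units.mk0 (-B * r) (mul_ne_zero (neg_ne_zero.2 (by exact_mod_cast h.B_ne_zero))
    (by exact_mod_cast hr.out.ne_zero))

theorem coe_unitA (h : TwistHypotheses A B r) : (h.unitA : ℚ) = -A * r := rfl

theorem coe_unitB (h : TwistHypotheses A B r) : (h.unitB : ℚ) = -B * r := rfl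

theorem unitA_mem (h : TwistHypotheses A B r) : h.unitA ∈ dualLift A B r :=
  h.mem_dualLift_of_point _ (y := 0) (by rw [coe_unitA]; ring)

theorem unitB_mem (h : TwistHypotheses A B r) : h.unitB ∈ dualLift A B r :=
  h.mem_dualLift_of_point _ (y := 0) (by rw [coe_unitB]; ring)

theorem exists_factor {q : ℤ} {D : ℤ} (hq : q.natAbs.Prime) (hD : Squarefree D) :
    ∃ D' : ℤ, (D = D' ∨ D = q * D') ∧ Squarefree D' ∧ ¬ q ∣ D' := by
  by_cases hqD : q ∣ D
  · obtain ⟨D', rfl⟩ := hqD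
    refine ⟨D', Or.inr rfl, hD.of_mul_right, fun hd => ?_⟩
    have := hD q (mul_dvd_mul_left _ hd)
    exact (Int.prime_iff_natAbs_prime.2 hq).not_isUnit this
  · exact ⟨D, Or.inl rfl, hD, hqD⟩

/-- The `φ̂`-descent: every Selmer class comes from a `2`-torsion point. -/
theorem isSquare_or_of_mem_dualLift (h : TwistHypotheses A B r) {d : ℚˣ}
    (hd : d ∈ dualLift A B r) :
    IsSquare (d : ℚ) ∨ IsSquare ((h.unitA * d : ℚˣ) : ℚ) ∨ IsSquare ((h.unitB * d : ℚˣ) : ℚ) ∨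
      IsSquare ((h.unitA * h.unitB * d : ℚˣ) : ℚ) := by
  obtain ⟨D, c, hD, -, hdc⟩ := exists_squarefree_mul_sq d d.ne_zero
  have hT := (torsorHasPoint_of_mem_selmerLift
    (mul_ne_zero (pow_ne_zero 2 h.sub_ne_zero) (pow_ne_zero 2 h.r_ne_zero)) hd hdc).1
  simp only [Rat.cast_intCast] at hT
  have hp : ∀ p : ℕ, p.Prime → (p : ℤ) ∣ D → (p : ℤ) ∣ A * B * r := fun p hp hpD =>
    haveI := Fact.mk hp
    dvd_of_dual_torsorHasPoint hD hpD (hT p)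
  obtain ⟨D₁, h1, hD1, hA1⟩ := exists_factor h.prime_A hD
  obtain ⟨D₂, h2, hD2, hB2⟩ := exists_factor h.prime_B hD1
  have h12 : D₂ ∣ D₁ := by rcases h2 with rfl | rfl <;> simp
  have h01 : D₁ ∣ D := by rcases h1 with rfl | rfl <;> simp
  have hA2 : ¬ A ∣ D₂ := fun hA => hA1 (hA.trans h12)
  have hdvd : D₂.natAbs ∣ r := by
    have := Squarefree.natAbs_dvd_of_primes (m := r) hD2 fun p hpp hpD => by
      have hpi := Nat.prime_iff_prime_int.1 hpp
      have aux : ∀ q : ℤ, q.natAbs.Prime → ¬ q ∣ D₂ → ¬ (p : ℤ) ∣ q := fun q hq hqD hpq => by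
        have he := (Nat.prime_dvd_prime_iff_eq hpp hq).1 (Int.natCast_dvd.1 hpq)
        rw [he] at hpD
        exact hqD (Int.natAbs_dvd.1 hpD)
      rcases hpi.dvd_or_dvd (hp p hpp (hpD.trans (h12.trans h01))) with h3 | h3
      · rcases hpi.dvd_or_dvd h3 with h4 | h4
        · exact absurd h4 (aux A h.prime_A hA2)
        · exact absurd h4 (aux B h.prime_B hB2)
      · exact h3
    simpa using this
  have he : D₂ = 1 ∨ D₂ = -1 ∨ D₂ = r ∨ D₂ = -r := by
    rcases (Nat.dvd_prime hr.out).1 hdvd with h3 | h3 <;> omega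
  clear hT hp hA1 hD1 hD2 hB2 h12 h01 hA2 hdvd hD
  have hmA := mul_mem h.unitA_mem hd
  have hmB := mul_mem h.unitB_mem hd
  have hmAB := mul_mem (mul_mem h.unitA_mem h.unitB_mem) hd
  have eA : ((h.unitA * d : ℚˣ) : ℚ) = -A * r * (D * c ^ 2) := by
    rw [Units.val_mul, coe_unitA, hdc]
  have eB : ((h.unitB * d : ℚˣ) : ℚ) = -B * r * (D * c ^ 2) := by
    rw [Units.val_mul, coe_unitB, hdc]
  have eAB : ((h.unitA * h.unitB * d : ℚˣ) : ℚ) = A * B * r ^ 2 * (D * c ^ 2) := by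
    rw [Units.val_mul, Units.val_mul, coe_unitA, coe_unitB, hdc]; ring
  -- If just one of `A`, `B` was removed from `D`, multiplying by its torsion class leaves `-r D₂`,
  -- again one of `±1`, `±r` up to squares. If both were removed, the product `A B r²` leaves `D₂`
  -- itself.
  have twist_cases : ∀ {x : ℚˣ} {s : ℚ}, x ∈ dualLift A B r → (x : ℚ) = -r * D₂ * s ^ 2 →
      IsSquare (x : ℚ) := by
    intro x s hx hs
    rcases he with rfl | rfl | rfl | rfl
    · exact h.isSquare_of_mem_dualLift hx (e := -r) (c := s) (by simp) (by rw [hs]; push_cast; ring)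
    · exact h.isSquare_of_mem_dualLift hx (e := r) (c := s) (by simp) (by rw [hs]; push_cast; ring)
    · exact h.isSquare_of_mem_dualLift hx (e := -1) (c := r * s) (by simp)
        (by rw [hs]; push_cast; ring)
    · exact h.isSquare_of_mem_dualLift hx (e := 1) (c := r * s) (by simp)
        (by rw [hs]; push_cast; ring)
  rcases h1 with rfl | rfl <;> rcases h2 with rfl | rfl
  · exact Or.inl (h.isSquare_of_mem_dualLift hd he hdc)
  · refine Or.inr (Or.inr (Or.inl (twist_cases (s := B * c) hmB ?_)))
    rw [eB]; push_cast; ring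
  · refine Or.inr (Or.inl (twist_cases (s := A * c) hmA ?_))
    rw [eA]; push_cast; ring
  · refine Or.inr (Or.inr (Or.inr (h.isSquare_of_mem_dualLift hmAB (c := A * B * r * c) he ?_)))
    rw [eAB]; push_cast; ring

theorem not_isSquare_unitA (h : TwistHypotheses A B r) : ¬ IsSquare (h.unitA : ℚ) := by
  rw [coe_unitA, show (-A * r : ℚ) = (((r : ℤ) * -A : ℤ) : ℚ) by push_cast; ring,
    Rat.isSquare_intCast_iff]
  refine not_isSquare_prime_mul hr.out fun hd => h.not_dvd ?_
  exact dvd_mul_of_dvd_left (dvd_mul_of_dvd_left ((dvd_neg).1 hd) _) _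

theorem not_isSquare_unitB (h : TwistHypotheses A B r) : ¬ IsSquare (h.unitB : ℚ) := by
  rw [coe_unitB, show (-B * r : ℚ) = (((r : ℤ) * -B : ℤ) : ℚ) by push_cast; ring,
    Rat.isSquare_intCast_iff]
  refine not_isSquare_prime_mul hr.out fun hd => h.not_dvd ?_
  exact dvd_mul_of_dvd_left (dvd_mul_of_dvd_right ((dvd_neg).1 hd) _) _

/-- The product is `A B r²`, which the prime `|A|` divides exactly once, being different from `|B|`
and `r`. -/
theorem not_isSquare_unitA_mul_unitB (h : TwistHypotheses A B r) :
    ¬ IsSquare ((h.unitA * h.unitB : ℚˣ) : ℚ) := by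
  have hpA := Nat.prime_iff_prime_int.1 h.prime_A
  obtain ⟨s, hs⟩ : ∃ s : ℤ, A = (A.natAbs : ℤ) * s ∧ s.natAbs = 1 := by
    rcases Int.natAbs_eq A with h1 | h1
    · exact ⟨1, by omega, rfl⟩
    · exact ⟨-1, by omega, rfl⟩
  rw [Units.val_mul, coe_unitA, coe_unitB,
    show (-A * r * (-B * r) : ℚ) = ((A * (B * r ^ 2) : ℤ) : ℚ) by push_cast; ring,
    Rat.isSquare_intCast_iff, hs.1, mul_assoc]
  refine not_isSquare_prime_mul h.prime_A fun hd => ?_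
  have hne : ∀ q : ℤ, q.natAbs.Prime → A.natAbs ≠ q.natAbs → ¬ (A.natAbs : ℤ) ∣ q := fun q hq hAq hd =>
    hAq ((Nat.prime_dvd_prime_iff_eq h.prime_A hq).1 (Int.natCast_dvd.1 hd))
  rcases hpA.dvd_or_dvd hd with h1 | h1
  · have := Int.natCast_dvd.1 h1
    rw [hs.2, Nat.dvd_one] at this
    exact h.prime_A.one_lt.ne' this
  · rcases hpA.dvd_or_dvd h1 with h1 | h1
    · exact hne B h.prime_B h.natAbs_ne h1
    · exact hne r (by simpa using hr.out) (by simpa using h.natAbs_A_ne) (hpA.dvd_of_dvd_pow h1)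

theorem selmer_eq_bot (h : TwistHypotheses A B r) : selmer (twist (curveAB A B) r) = ⊥ := by
  rw [twist_curveAB, eq_bot_iff]
  rintro _ ⟨d, hd, rfl⟩
  rw [Subgroup.mem_bot, squareClass_eq_one_iff]
  refine h.isSquare_of_mem_selmerLift ?_
  have e1 : (((A + B) * r : ℤ) : ℚ) = (A + B) * r := by push_cast; ring
  have e2 : ((A * B * r ^ 2 : ℤ) : ℚ) = A * B * r ^ 2 := by push_cast; ring
  rw [e1, e2]
  exact hd

theorem selmer_dual_isKleinFour (h : TwistHypotheses A B r) :
    IsKleinFour (selmer (dualCurve (twist (curveAB A B) r))) := by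
  have e : selmer (dualCurve (twist (curveAB A B) r)) =
      (dualLift A B r).map (QuotientGroup.mk' _) := by
    rw [dualCurve_twist_curveAB]
    have e1 : ((-2 * ((A + B) * r) : ℤ) : ℚ) = -2 * (A + B) * r := by push_cast; ring
    have e2 : (((A - B) ^ 2 * r ^ 2 : ℤ) : ℚ) = (A - B) ^ 2 * r ^ 2 := by push_cast; ring
    unfold dualLift
    rw [e1, e2]
    rfl
  rw [e]
  refine isKleinFour_of_forall_mem_iff squareClass_sq _
    (α := QuotientGroup.mk' _ h.unitA) (β := QuotientGroup.mk' _ h.unitB) ?_ ?_ ?_ ?_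
  · rw [Ne, squareClass_eq_one_iff]; exact h.not_isSquare_unitA
  · rw [Ne, squareClass_eq_one_iff]; exact h.not_isSquare_unitB
  · rw [← map_mul, Ne, squareClass_eq_one_iff]; exact h.not_isSquare_unitA_mul_unitB
  · intro x
    constructor
    · rintro ⟨d, hd, rfl⟩
      rw [← map_mul, squareClass_eq_iff d h.unitA, squareClass_eq_iff d h.unitB,
        squareClass_eq_iff d (h.unitA * h.unitB), squareClass_eq_one_iff]
      exact h.isSquare_or_of_mem_dualLift hd
    · rintro (rfl | rfl | rfl | rfl)
      · exact one_mem _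
      · exact Subgroup.mem_map_of_mem _ h.unitA_mem
      · exact Subgroup.mem_map_of_mem _ h.unitB_mem
      · exact mul_mem (Subgroup.mem_map_of_mem _ h.unitA_mem)
          (Subgroup.mem_map_of_mem _ h.unitB_mem)

end TwistHypotheses

/-! ### Heights under 2-isogenies and Möbius maps. -/

section Heights

open Height MvPolynomial

/-- The `x`-coordinate of a `2`-isogeny at least doubles the height, up to a constant. -/
theorem exists_logHeight_isogeny_ge {K : Type*} [Field K] [AdmissibleAbsValues K] (a b : K)
    (hb : b ≠ 0) :
    ∃ C : ℝ, ∀ x : K, x ≠ 0 → 2 * logHeight₁ x ≤ logHeight₁ (x + a + b / x) + C := by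
  let p : Fin 2 → MvPolynomial (Fin 2) K :=
    ![X 0 ^ 2 + C a * (X 0 * X 1) + C b * X 1 ^ 2, X 0 * X 1]
  -- The rows of `q` express `X 0 ^ 4` and `X 1 ^ 4` as combinations of the two forms in `p`; this
  -- Nullstellensatz certificate gives the lower height bound and is where `b ≠ 0` enters.
  let q : Fin 2 × Fin 2 → MvPolynomial (Fin 2) K := Function.uncurry
    ![![X 0 ^ 2, C (-a) * X 0 ^ 2 + C (-b) * (X 0 * X 1)],
      ![C b⁻¹ * X 1 ^ 2, C (-a * b⁻¹) * X 1 ^ 2 + C (-b⁻¹) * (X 0 * X 1)]]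
  have h2 : ∀ i : Fin 2, (X i ^ 2 : MvPolynomial (Fin 2) K).IsHomogeneous 2 := fun i =>
    isHomogeneous_X_pow i 2
  have h11 : (X 0 * X 1 : MvPolynomial (Fin 2) K).IsHomogeneous 2 :=
    (isHomogeneous_X K 0).mul (isHomogeneous_X K 1)
  have hq : ∀ i, (q i).IsHomogeneous 2 := by
    rintro ⟨i, j⟩
    fin_cases i <;> fin_cases j
    · exact h2 0
    · exact ((h2 0).C_mul _).add (h11.C_mul _)
    · exact (h2 1).C_mul _
    · exact ((h2 1).C_mul _).add (h11.C_mul _)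
  obtain ⟨c, hc⟩ := logHeight_eval_ge' (N := 2) hq
  refine ⟨-c, fun x hx => ?_⟩
  have h := hc p (x := ![x, 1]) (by
    intro k
    fin_cases k
    · simp [p, q, Fin.sum_univ_two]; ring
    · simp [p, q, Fin.sum_univ_two]; field_simp; ring)
  have e : (fun j => (p j).eval ![x, 1]) = ![x ^ 2 + a * x + b, x] := by
    funext j; fin_cases j <;> simp [p]
  rw [e, ← logHeight₁_eq_logHeight x, ← logHeight₁_div_eq_logHeight] at h
  have e2 : (x ^ 2 + a * x + b) / x = x + a + b / x := by field_simp
  rw [e2] at h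
  push_cast at h
  linarith

/-- Translation by a 2-torsion point acts on abscissas by a map of this shape, so it raises the
height by at most a constant. -/
theorem exists_logHeight_add_div_le {K : Type*} [Field K] [AdmissibleAbsValues K] (e c f : K) :
    ∃ C : ℝ, ∀ x : K, logHeight₁ (e + c / (x + f)) ≤ logHeight₁ x + C := by
  refine ⟨totalWeight K * Real.log 2 + logHeight₁ e + logHeight₁ c +
    (totalWeight K * Real.log 2 + logHeight₁ f), fun x => ?_⟩
  have h1 := logHeight₁_add_le e (c / (x + f))
  have h2 := logHeight₁_mul_le c (x + f)⁻¹
  rw [logHeight₁_inv, ← div_eq_mul_inv] at h2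
  have h3 := logHeight₁_add_le x f
  linarith

end Heights

/-! ### Infinite descent in an abelian group with a height. -/

section Descent

/-- Infinite descent: a group with a height function on which points can be halved up to
`2`-torsion, and in which halving decreases the height, is a torsion group. -/
theorem exists_zsmul_eq_zero_of_descent {G : Type*} [AddCommGroup G] (ht : G → ℝ) (C : ℝ)
    (hfin : ∀ b : ℝ, {P : G | ht P ≤ b}.Finite)
    (hdesc : ∀ P : G, ∃ Q : G, (4 : ℤ) • Q = (2 : ℤ) • P ∧ 4 * ht Q ≤ ht P + C) (P : G) :
    ∃ n : ℤ, n ≠ 0 ∧ n • P = 0 := by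
  choose f hf hle using hdesc
  set b := max (ht P) (max C 0) with hb
  have hbC : C ≤ b := (le_max_left _ _).trans (le_max_right _ _)
  have hb0 : 0 ≤ b := (le_max_right _ _).trans (le_max_right _ _)
  have hmem : ∀ n, ht (f^[n] P) ≤ b := by
    intro n
    induction n with
    | zero => exact le_max_left _ _
    | succ n ih =>
      rw [Function.iterate_succ_apply']
      have := hle (f^[n] P)
      linarith
  -- Since `f` halves only up to 2-torsion, one extra factor of two is carried throughout; it
  -- reappears in the final annihilator `(2 ^ (k + 2) - 2) * 2`.
  have hiter : ∀ (n : ℕ) (R : G), (2 ^ (n + 1) : ℤ) • f^[n] R = (2 : ℤ) • R := by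
    intro n R
    induction n with
    | zero => simp
    | succ n ih =>
      rw [Function.iterate_succ_apply', show (2 ^ (n + 1 + 1) : ℤ) = 2 ^ n * 4 by ring, mul_smul,
        hf, ← mul_smul, ← ih, pow_succ]
  have := (hfin b).to_subtype
  obtain ⟨i, j, hij, he⟩ := Finite.exists_ne_map_eq_of_infinite
    (fun n : ℕ => (⟨f^[n] P, hmem n⟩ : {P : G | ht P ≤ b}))
  have he' : f^[i] P = f^[j] P := congrArg Subtype.val he
  clear he
  wlog hlt : i < j generalizing i j
  · exact this j i hij.symm he'.symm (lt_of_le_of_ne (not_lt.1 hlt) hij.symm)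
  obtain ⟨k, rfl⟩ := Nat.exists_eq_add_of_lt hlt
  rw [show i + k + 1 = (k + 1) + i by ring, Function.iterate_add_apply] at he'
  have h1 := hiter (k + 1) (f^[i] P)
  rw [← he'] at h1
  have h2 : (2 ^ (k + 1 + 1) - 2 : ℤ) • f^[i] P = 0 := by rw [sub_smul, h1, sub_self]
  refine ⟨(2 ^ (k + 1 + 1) - 2) * 2, ?_, ?_⟩
  · have : (1 : ℤ) ≤ 2 ^ k := one_le_pow₀ (by norm_num)
    rw [pow_succ, pow_succ]
    omega
  · rw [mul_smul, ← hiter i P, ← mul_smul, mul_comm, mul_smul, h2, smul_zero]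

end Descent

/-! ### Halving points on a curve with full rational 2-torsion. -/

section Points

open Height

variable {m n : ℚ}

/-- The curve `y² = x (x + m) (x + n)`. -/
abbrev fullTorsionCurve (m n : ℚ) : WeierstrassCurve ℚ := curve2 (m + n) (m * n)

theorem fullTorsionCurve_equation {x y : ℚ} : Affine.Equation (fullTorsionCurve m n) x y ↔
    y ^ 2 = x * (x + m) * (x + n) := by
  rw [Affine.equation_iff]
  simp only [curve2]
  constructor <;> intro h <;> linear_combination h

theorem fullTorsionCurve_nonsingular (hm : m ≠ 0) (hn : n ≠ 0) (hmn : m ≠ n) {x y : ℚ}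
    (h : y ^ 2 = x * (x + m) * (x + n)) : Affine.Nonsingular (fullTorsionCurve m n) x y := by
  rw [Affine.nonsingular_iff]
  refine ⟨fullTorsionCurve_equation.2 h, ?_⟩
  simp only [curve2]
  by_cases hy : y = 0
  · left
    subst hy
    have h0 : x * (x + m) * (x + n) = 0 := by rw [← h]; ring
    intro h1
    rcases mul_eq_zero.1 h0 with h2 | h2
    · rcases mul_eq_zero.1 h2 with rfl | h3
      · exact mul_ne_zero hm hn (by linear_combination -h1)
      · obtain rfl : x = -m := eq_neg_of_add_eq_zero_left h3
        exact mul_ne_zero hm (sub_ne_zero.2 hmn) (by linear_combination -h1)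
    · obtain rfl : x = -n := eq_neg_of_add_eq_zero_left h2
      exact mul_ne_zero hn (sub_ne_zero.2 hmn) (by linear_combination h1)
  · right
    intro h1
    exact hy (by linear_combination h1 / 2)

theorem point_some_congr {W : WeierstrassCurve ℚ} {x y x' y' : ℚ} (hn : Affine.Nonsingular W x y)
    (hx : x = x') (hy : y = y') :
    ∃ h', Affine.Point.some x y hn = Affine.Point.some x' y' h' := by
  subst hx hy
  exact ⟨hn, rfl⟩

theorem add_self_eq_zero_of_y_eq_zero {x : ℚ} (h : Affine.Nonsingular (fullTorsionCurve m n) x 0) :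
    Affine.Point.some x 0 h + Affine.Point.some x 0 h = 0 :=
  Affine.Point.add_of_Y_eq rfl (by simp [Affine.negY, curve2])

/-- A point is divisible by `2` if `x`, `x + m` and `x + n` are squares. -/
theorem exists_half (hm : m ≠ 0) (hn : n ≠ 0) (hmn : m ≠ n) {x y α β γ : ℚ}
    (h : Affine.Nonsingular (fullTorsionCurve m n) x y)
    (hα : x = α ^ 2) (hβ : x + m = β ^ 2) (hγ : x + n = γ ^ 2) (hy : y = α * β * γ) :
    ∃ (xQ yQ : ℚ) (hQ : Affine.Nonsingular (fullTorsionCurve m n) xQ yQ),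
      Affine.Point.some xQ yQ hQ + Affine.Point.some xQ yQ hQ = Affine.Point.some x y h ∧
      xQ = (α + β) * (α + γ) ∧ α + β ≠ 0 ∧ α + γ ≠ 0 ∧ β + γ ≠ 0 := by
  obtain rfl : m = β ^ 2 - α ^ 2 := by linear_combination hβ - hα
  obtain rfl : n = γ ^ 2 - α ^ 2 := by linear_combination hγ - hα
  have h1 : α + β ≠ 0 := fun h => hm (by linear_combination (β - α) * h)
  have h2 : α + γ ≠ 0 := fun h => hn (by linear_combination (γ - α) * h)
  have h3 : β + γ ≠ 0 := fun h => hmn (by linear_combination (β - γ) * h)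
  -- For this `Q` the factors are `x = (α + β)(α + γ)`, `x + m = (α + β)(β + γ)` and `x + n = (α +
  -- γ)(β + γ)`; the tangent at `Q` has slope `α + β + γ`.
  have hQ := fullTorsionCurve_nonsingular hm hn hmn (x := (α + β) * (α + γ))
    (y := (α + β) * (β + γ) * (α + γ)) (by ring)
  refine ⟨_, _, hQ, ?_, rfl, h1, h2, h3⟩
  set yQ := (α + β) * (β + γ) * (α + γ) with hyQ
  have hyQ0 : yQ ≠ 0 := mul_ne_zero (mul_ne_zero h1 h3) h2
  have hY : yQ ≠ Affine.negY (fullTorsionCurve (β ^ 2 - α ^ 2) (γ ^ 2 - α ^ 2))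
      ((α + β) * (α + γ)) yQ := by
    simp only [Affine.negY, curve2]
    intro h
    exact hyQ0 (by linear_combination h / 2)
  have hs : Affine.slope (fullTorsionCurve (β ^ 2 - α ^ 2) (γ ^ 2 - α ^ 2))
      ((α + β) * (α + γ)) ((α + β) * (α + γ)) yQ yQ = α + β + γ := by
    rw [Affine.slope_of_Y_ne rfl hY, div_eq_iff (sub_ne_zero.2 hY)]
    simp only [Affine.negY, curve2, hyQ]
    ring
  rw [Affine.Point.add_self_of_Y_ne hY]
  obtain ⟨h', e'⟩ := point_some_congr (x' := x) (y' := y)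
    (Affine.nonsingular_add hQ hQ fun hxy => hY hxy.right) (by
      rw [hs, hα]; simp only [Affine.addX, curve2]; ring) (by
      rw [hs, hy]; simp only [Affine.addY, Affine.negAddY, Affine.negY, Affine.addX, curve2, hyQ]
      ring)
  exact e'

theorem exists_add_torsion {x y e : ℚ} (h : Affine.Nonsingular (fullTorsionCurve m n) x y)
    (he : Affine.Nonsingular (fullTorsionCurve m n) e 0) (hx : x ≠ e) :
    ∃ (x' y' : ℚ) (h' : Affine.Nonsingular (fullTorsionCurve m n) x' y'),
      (2 : ℤ) • Affine.Point.some x' y' h' = (2 : ℤ) • Affine.Point.some x y h ∧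
      x' = (y / (x - e)) ^ 2 - (m + n) - x - e := by
  have h0 := add_self_eq_zero_of_y_eq_zero he
  rw [← two_zsmul] at h0
  have hadd := Affine.Point.add_of_X_ne (h₁ := h) (h₂ := he) hx
  refine ⟨_, _, Affine.nonsingular_add h he fun hxy => hx hxy.left, ?_, ?_⟩
  · rw [← hadd, zsmul_add, h0, add_zero]
  · rw [Affine.slope_of_X_ne hx]
    simp only [Affine.addX, curve2]
    ring

/-- The naive height of a point. -/
def pointHeight {W : WeierstrassCurve ℚ} (P : Affine.Point W) : ℝ := logHeight P.xRep

theorem pointHeight_some {W : WeierstrassCurve ℚ} {x y : ℚ} (h : Affine.Nonsingular W x y) :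
    pointHeight (Affine.Point.some x y h) = logHeight₁ x := by
  rw [pointHeight, Affine.Point.xRep_some, logHeight₁_eq_logHeight]

theorem pointHeight_zero {W : WeierstrassCurve ℚ} : pointHeight (0 : Affine.Point W) = 0 := by
  rw [pointHeight, Affine.Point.xRep_zero, ← logHeight₁_div_eq_logHeight, div_zero,
    logHeight₁_zero]

theorem pointHeight_nonneg {W : WeierstrassCurve ℚ} (P : Affine.Point W) : 0 ≤ pointHeight P := by
  rcases P with _ | ⟨x, y, h⟩
  · exact pointHeight_zero.ge
  · rw [pointHeight_some]; exact zero_le_logHeight₁ x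

/-- Northcott's theorem bounds the abscissas, and each abscissa belongs to at most two points, `P`
and `-P`. -/
theorem finite_pointHeight_le (W : WeierstrassCurve ℚ) (b : ℝ) :
    {P : Affine.Point W | pointHeight P ≤ b}.Finite := by
  have hs : (insert ![1, 0] ((fun x : ℚ => ![x, 1]) '' {x : ℚ | logHeight₁ x ≤ b})).Finite :=
    ((NumberField.finite_setOfPred_logHeight₁_le ℚ b).image _).insert _
  refine (hs.preimage' (f := fun P : Affine.Point W => P.xRep) fun v _ => ?_).subset ?_
  · rcases Set.eq_empty_or_nonempty ((fun P : Affine.Point W => P.xRep) ⁻¹' {v}) with h | ⟨P, hP⟩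
    · rw [h]; exact Set.finite_empty
    · refine (Set.toFinite {P, -P}).subset fun Q hQ => ?_
      exact Affine.Point.eq_or_eq_neg_of_xRep_eq_xRep (hQ.trans hP.symm)
  · rintro (_ | ⟨x, y, h⟩) hP
    · exact Or.inl rfl
    · refine Or.inr ⟨x, ?_, rfl⟩
      rw [Set.mem_ofPred_eq, pointHeight_some] at hP
      exact hP

/-- Doubling is the composite of the 2-isogeny and its dual. On abscissas it passes from `xQ`
through `(β + γ)²` to `4 x`, and each step at least doubles the height up to a constant. -/
theorem exists_half_height (hm : m ≠ 0) (hn : n ≠ 0) (hmn : m ≠ n) : ∃ C : ℝ,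
    ∀ {x y : ℚ} (h : Affine.Nonsingular (fullTorsionCurve m n) x y),
      IsSquare x → IsSquare (x + m) → IsSquare (x + n) →
      ∃ Q : Affine.Point (fullTorsionCurve m n), Q + Q = Affine.Point.some x y h ∧
        4 * pointHeight Q ≤ logHeight₁ x + C := by
  obtain ⟨C₁, hC₁⟩ := exists_logHeight_isogeny_ge (m + n) (m * n) (mul_ne_zero hm hn)
  obtain ⟨C₂, hC₂⟩ := exists_logHeight_isogeny_ge (-2 * (m + n)) ((m - n) ^ 2)
    (pow_ne_zero 2 (sub_ne_zero.2 hmn))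
  refine ⟨logHeight₁ (4 : ℚ) + C₂ + 2 * C₁, ?_⟩
  rintro x y h ⟨α, hα⟩ ⟨β, hβ⟩ ⟨γ, hγ⟩
  rw [← pow_two] at hα hβ hγ
  have heq := fullTorsionCurve_equation.1 h.1
  -- The three roots are determined only up to sign; the sign of `α` is chosen to match `y`.
  obtain ⟨α, hα, hy⟩ : ∃ α, x = α ^ 2 ∧ y = α * β * γ := by
    have : y = α * β * γ ∨ y = -(α * β * γ) := by
      apply sq_eq_sq_iff_eq_or_eq_neg.1
      rw [heq, hβ, hγ, hα]; ring
    rcases this with h1 | h1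
    · exact ⟨α, hα, h1⟩
    · exact ⟨-α, by rw [hα]; ring, by rw [h1]; ring⟩
  obtain ⟨xQ, yQ, hQ, h2, hx, h3, h4, h5⟩ := exists_half hm hn hmn h hα hβ hγ hy
  refine ⟨_, h2, ?_⟩
  rw [pointHeight_some]
  have hm' : m = β ^ 2 - α ^ 2 := by linear_combination hβ - hα
  have hn' : n = γ ^ 2 - α ^ 2 := by linear_combination hγ - hα
  have hx0 : xQ ≠ 0 := by rw [hx]; exact mul_ne_zero h3 h4
  have e1 : xQ + (m + n) + m * n / xQ = (β + γ) ^ 2 := by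
    rw [hx, hm', hn']; field_simp; ring
  have e2 : (β + γ) ^ 2 + -2 * (m + n) + (m - n) ^ 2 / (β + γ) ^ 2 = 4 * x := by
    rw [hα, hm', hn']; field_simp; ring
  have i1 := hC₁ xQ hx0
  have i2 := hC₂ ((β + γ) ^ 2) (pow_ne_zero 2 h5)
  rw [e1] at i1
  rw [e2] at i2
  have i3 := logHeight₁_mul_le 4 x
  linarith

/-- A complete `2`-descent on `y² = x (x + m) (x + n)` in which only the `2`-torsion points
contribute shows that all rational points are torsion. -/
theorem torsion_of_descent (hm : m ≠ 0) (hn : n ≠ 0) (hmn : m ≠ n)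
    (hdual : ∀ x y : ℚ, x ≠ 0 → y ^ 2 = x * (x + m) * (x + n) →
      IsSquare x ∨ IsSquare (-m * x) ∨ IsSquare (-n * x) ∨ IsSquare (m * n * x))
    (hphi : ∀ x y : ℚ, x ≠ 0 → y ^ 2 = x * (x + m) * (x + n) → IsSquare x →
      IsSquare (x + m) ∧ IsSquare (x + n)) (P : Affine.Point (fullTorsionCurve m n)) :
    ∃ k : ℤ, k ≠ 0 ∧ k • P = 0 := by
  obtain ⟨C, hC⟩ := exists_half_height hm hn hmn
  obtain ⟨C₀, hC₀⟩ := exists_logHeight_add_div_le (0 : ℚ) (m * n) 0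
  obtain ⟨C₁, hC₁⟩ := exists_logHeight_add_div_le (-m) (m * (m - n)) m
  obtain ⟨C₂, hC₂⟩ := exists_logHeight_add_div_le (-n) (n * (n - m)) n
  have t0 := fullTorsionCurve_nonsingular hm hn hmn (x := 0) (y := 0) (by ring)
  have t1 := fullTorsionCurve_nonsingular hm hn hmn (x := -m) (y := 0) (by ring)
  have t2 := fullTorsionCurve_nonsingular hm hn hmn (x := -n) (y := 0) (by ring)
  refine exists_zsmul_eq_zero_of_descent pointHeight (|C| + (|C₀| + |C₁| + |C₂|))
    (finite_pointHeight_le _) (fun P => ?_) P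
  have hpos : 0 ≤ |C| + (|C₀| + |C₁| + |C₂|) := by positivity
  have zero_case : (2 : ℤ) • P = 0 → ∃ Q : Affine.Point (fullTorsionCurve m n),
      (4 : ℤ) • Q = (2 : ℤ) • P ∧
      4 * pointHeight Q ≤ pointHeight P + (|C| + (|C₀| + |C₁| + |C₂|)) := fun h => by
    refine ⟨0, by rw [h, zsmul_zero], ?_⟩
    have := pointHeight_nonneg P
    rw [pointHeight_zero]
    linarith
  rcases P with _ | ⟨x, y, h⟩
  · exact zero_case (zsmul_zero _)
  by_cases hy : y = 0
  · subst hy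
    exact zero_case (by rw [two_zsmul]; exact add_self_eq_zero_of_y_eq_zero h)
  have heq := fullTorsionCurve_equation.1 h.1
  have hprod : x * (x + m) * (x + n) ≠ 0 := heq ▸ pow_ne_zero 2 hy
  have hx0 : x ≠ 0 := left_ne_zero_of_mul (left_ne_zero_of_mul hprod)
  have hxm : x + m ≠ 0 := right_ne_zero_of_mul (left_ne_zero_of_mul hprod)
  have hxn : x + n ≠ 0 := right_ne_zero_of_mul hprod
  -- It suffices to find a translate of the point by 2-torsion with square abscissa: `hphi` then
  -- makes it divisible, and half of it, taken four times, is twice the original point.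
  have key : ∀ (x' y' : ℚ) (h' : Affine.Nonsingular (fullTorsionCurve m n) x' y') (K : ℝ),
      (2 : ℤ) • Affine.Point.some x' y' h' = (2 : ℤ) • Affine.Point.some x y h →
      x' ≠ 0 → IsSquare x' → logHeight₁ x' ≤ logHeight₁ x + K → K ≤ |C₀| + |C₁| + |C₂| →
      ∃ Q : Affine.Point (fullTorsionCurve m n),
        (4 : ℤ) • Q = (2 : ℤ) • Affine.Point.some x y h ∧ 4 * pointHeight Q ≤
          pointHeight (Affine.Point.some x y h) + (|C| + (|C₀| + |C₁| + |C₂|)) := by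
    intro x' y' h' K h2 hx' hsq hK hK'
    obtain ⟨hs1, hs2⟩ := hphi x' y' hx' (fullTorsionCurve_equation.1 h'.1) hsq
    obtain ⟨Q, hQ, hQh⟩ := hC h' hsq hs1 hs2
    refine ⟨Q, ?_, ?_⟩
    · rw [← h2, ← hQ, ← two_zsmul, ← mul_zsmul]; rfl
    · rw [pointHeight_some]
      have := le_abs_self C
      linarith
  have a0 := abs_nonneg C₀
  have a1 := abs_nonneg C₁
  have a2 := abs_nonneg C₂
  have l0 := le_abs_self C₀
  have l1 := le_abs_self C₁
  have l2 := le_abs_self C₂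
  -- Each alternative names the 2-torsion point whose class agrees with that of `x`; adding that
  -- point makes the abscissa a square.
  rcases hdual x y hx0 heq with hsq | ⟨s, hs⟩ | ⟨s, hs⟩ | ⟨s, hs⟩
  · exact key x y h 0 rfl hx0 hsq (by rw [add_zero]) (by linarith)
  · obtain ⟨x', y', h', e2, ex⟩ := exists_add_torsion h t1 (x := x)
      (fun hh => hxm (by rw [hh]; ring))
    have ex' : x' = -m * (x + n) / (x + m) := by
      simp only [ex, sub_neg_eq_add, div_pow, heq]; field_simp; ring
    refine key x' y' h' C₁ e2 ?_ ⟨y * s / (x * (x + m)), ?_⟩ ?_ (by linarith)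
    · rw [ex']; exact div_ne_zero (mul_ne_zero (neg_ne_zero.2 hm) hxn) hxm
    · rw [← pow_two, div_pow, mul_pow, heq, pow_two s, ← hs, ex']; field_simp
    · convert hC₁ x using 2
      rw [ex']; field_simp; ring
  · obtain ⟨x', y', h', e2, ex⟩ := exists_add_torsion h t2 (x := x)
      (fun hh => hxn (by rw [hh]; ring))
    have ex' : x' = -n * (x + m) / (x + n) := by
      simp only [ex, sub_neg_eq_add, div_pow, heq]; field_simp; ring
    refine key x' y' h' C₂ e2 ?_ ⟨y * s / (x * (x + n)), ?_⟩ ?_ (by linarith)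
    · rw [ex']; exact div_ne_zero (mul_ne_zero (neg_ne_zero.2 hn) hxm) hxn
    · rw [← pow_two, div_pow, mul_pow, heq, pow_two s, ← hs, ex']; field_simp
    · convert hC₂ x using 2
      rw [ex']; field_simp; ring
  · obtain ⟨x', y', h', e2, ex⟩ := exists_add_torsion h t0 (x := x) hx0
    have ex' : x' = m * n / x := by
      rw [ex, sub_zero, div_pow, heq]; field_simp; ring
    refine key x' y' h' C₀ e2 ?_ ⟨s / x, ?_⟩ ?_ (by linarith)
    · rw [ex']; exact div_ne_zero (mul_ne_zero hm hn) hx0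
    · rw [← pow_two, div_pow, pow_two s, ← hs, ex']; field_simp
    · convert hC₀ x using 2
      rw [ex', add_zero, zero_add]

end Points

/-! ### Vanishing of the Mordell-Weil rank. -/

namespace TwistHypotheses

variable {A B : ℤ} {r : ℕ} [hr : Fact r.Prime]

/-- With `x = α²` and `y = δ α`, the number `X = 2 x + (A + B) r + 2 δ` satisfies `(X - (A + B) r)²
- 4 A B r² = 4 x X`. So `t = 1`, `u = 2 α X` is a rational point on the torsor of `X`, and the
triviality of the `φ`-Selmer group makes `X` a square. -/
theorem isSquare_add_of_isSquare (h : TwistHypotheses A B r) {x y : ℚ} (hx : x ≠ 0)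
    (hy : y ^ 2 = x * (x + A * r) * (x + B * r)) (hsq : IsSquare x) :
    IsSquare (x + A * r) ∧ IsSquare (x + B * r) := by
  obtain ⟨α, hα⟩ := hsq
  have hα0 : α ≠ 0 := by rintro rfl; exact hx (by rw [hα, mul_zero])
  obtain ⟨δ, rfl⟩ : ∃ δ, y = δ * α := ⟨y / α, by field_simp⟩
  have hδ : δ ^ 2 = (x + A * r) * (x + B * r) :=
    mul_left_cancel₀ hx (by linear_combination hy + δ ^ 2 * hα)
  have hr0 : (r : ℚ) ≠ 0 := by exact_mod_cast hr.out.ne_zero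
  have hAB : (A - B : ℚ) ≠ 0 := by exact_mod_cast h.sub_ne_zero
  have hprod : (2 * x + (A + B) * r + 2 * δ) * (2 * x + (A + B) * r - 2 * δ) =
      ((A - B) * r) ^ 2 := by linear_combination -4 * hδ
  have hX : 2 * x + (A + B) * r + 2 * δ ≠ 0 :=
    left_ne_zero_of_mul (hprod ▸ pow_ne_zero 2 (mul_ne_zero hAB hr0))
  obtain ⟨μ, hμ⟩ := h.isSquare_of_mem_selmerLift (d := Units.mk0 _ hX)
    (mem_selmerLift_of_torsor (t := 1) (u := 2 * α * (2 * x + (A + B) * r + 2 * δ))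
      (Int.cast_ne_zero.2 (mul_ne_zero (mul_ne_zero h.A_ne_zero h.B_ne_zero)
        (pow_ne_zero 2 h.r_ne_zero))) _ one_ne_zero (by
      rw [Units.val_mk0]
      push_cast
      linear_combination (2 * x + (A + B) * r + 2 * δ) * (-4 * (2 * x + (A + B) * r + 2 * δ) * hα
        - 4 * hδ)))
  rw [Units.val_mk0] at hμ
  have hμ0 : μ ≠ 0 := by rintro rfl; exact hX (by rw [hμ, mul_zero])
  rw [hμ] at hprod
  constructor
  -- If `β² = x + A r` and `γ² = x + B r`, then `μ` plays the role of `β + γ` and `(A - B) r / μ`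
  -- that of `β - γ`.
  · refine ⟨(μ + (A - B) * r / μ) / 2, ?_⟩
    field_simp
    linear_combination hprod + μ ^ 2 * hμ
  · refine ⟨(μ - (A - B) * r / μ) / 2, ?_⟩
    field_simp
    linear_combination hprod + μ ^ 2 * hμ

theorem mordellWeilRank_eq_zero (h : TwistHypotheses A B r) :
    mordellWeilRank (twist (curveAB A B) r) = 0 := by
  have e : twist (curveAB A B) r = fullTorsionCurve ((A : ℚ) * r) ((B : ℚ) * r) := by
    rw [twist_curveAB]
    congr 1 <;> ring
  have hr0 : (r : ℚ) ≠ 0 := by exact_mod_cast hr.out.ne_zero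
  rw [mordellWeilRank, e, rank_eq_zero_iff]
  refine torsion_of_descent (mul_ne_zero (by exact_mod_cast h.A_ne_zero) hr0)
    (mul_ne_zero (by exact_mod_cast h.B_ne_zero) hr0) ?_ ?_
    fun x y hx hy hsq => h.isSquare_add_of_isSquare hx hy hsq
  · intro hAB
    have := mul_right_cancel₀ hr0 hAB
    exact h.sub_ne_zero (sub_eq_zero.2 (by exact_mod_cast this))
  · intro x y hx hy
    have := h.isSquare_or_of_mem_dualLift (h.mem_dualLift_of_point (Units.mk0 x hx) hy)
    simp only [Units.val_mul, coe_unitA, coe_unitB, Units.val_mk0] at this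
    have e1 : -((A : ℚ) * r) * x = -A * r * x := by ring
    have e2 : -((B : ℚ) * r) * x = -B * r * x := by ring
    have e3 : (A : ℚ) * r * (B * r) * x = -A * r * (-B * r) * x := by ring
    rw [e1, e2, e3]
    exact this

end TwistHypotheses

end TwoDescent
end

theorem theorem2 (A B : ℤ) (hA : A.natAbs.Prime) (hB : B.natAbs.Prime)
    (hA8 : A ≡ 1 [ZMOD 8]) (hB8 : B ≡ 3 [ZMOD 8])
    (hAB : 0 ≤ A + B ∨ A * B < 0)
    (r : ℕ) [Fact r.Prime] (hr : IsCoprime (r : ℤ) (A * B * (A - B)))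
    (hr8 : r ≡ 7 [MOD 8])
    (hrA : legendreSym r A = -1) (hrB : legendreSym r B = -1)
    (hp : ∀ (p : ℕ) [Fact p.Prime], p ≠ 2 → (p : ℤ) ∣ A - B →
      legendreSym p (-B * r) = -1) :
    TwoDescent.mordellWeilRank (TwoDescent.twist (TwoDescent.curveAB A B) r) = 0 ∧
    TwoDescent.selmer (TwoDescent.twist (TwoDescent.curveAB A B) r) = ⊥ ∧
    Nonempty
      (TwoDescent.selmer (TwoDescent.dualCurve (TwoDescent.twist (TwoDescent.curveAB A B) r)) ≃*
        Multiplicative (ZMod 2 × ZMod 2)) := by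
  have h : TwoDescent.TwistHypotheses A B r := ⟨hA, hB, hA8, hB8, hAB, hr, hr8, hrA, hrB, hp⟩
  have := h.selmer_dual_isKleinFour
  exact ⟨h.mordellWeilRank_eq_zero, h.selmer_eq_bot, IsKleinFour.nonempty_mulEquiv⟩
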